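/- Let $d\ge 1$. For a potential $W:\mathbb{R}^d\to[0,\infty]$ and a Borel measure $\rho\ge 0$ put $$E[\rho]=\frac12\int_{\mathbb{R}^d}\int_{\mathbb{R}^d}W(x-y)\,d\rho(y)\,d\rho(x)\in[0,\infty].$$ Let $\mathcal P_2(\mathbb{R}^d)$ be the set of Borel probability measures on $\mathbb{R}^d$ with finite second moment, and for probability measures $\mu,\nu$ let $d_\infty(\mu,\nu)=\inf_{\pi}\sup_{(x,y)\in\operatorname{supp}\pi}|y-x|\in[0,\infty]$, where $\pi$ runs over the measures on $\mathbb{R}^d\times\mathbb{R}^d$ with marginals $\mu$ and $\nu$. A Borel probability measure $\rho$ is a $d_\infty$-local minimizer of $E$ if there is $\varepsilon>0$ such that $E[\rho]\le E[\sigma]$ for every Borel probability measure $\sigma$ with $d_\infty(\rho,\sigma)<\varepsilon$. Assume: 1. (Hypothesis (H-s)) $W$ is locally integrable, lower semicontinuous and symmetric ($W(-x)=W(x)$); either $W$ is finite and continuous on $\mathbb{R}^d$, or $W$ is finite and continuous on $\mathbb{R}^d\setminus\{0\}$ and $W(0)=+\infty$; and for every $R>0$ there is $C_R>0$ such that $\frac{1}{|B(x;r)|}\int_{B(x;r)}W(y)\,dy\le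 C_R W(x)$ whenever $|x|\le R$ and $0<r\le R$. 2. $W$ is radially symmetric and $W\in C^4(\mathbb{R}^d\setminus\{0\})$. 3. (LIC) For all $\rho_0\ne\rho_1$ in $\mathcal P_2(\mathbb{R}^d)$ with $E[\rho_0],E[\rho_1]<\infty$ and the same center of mass, $t\mapsto E[(1-t)\rho_0+t\rho_1]$ is (finite and) strictly convex on $[0,1]$. 4. $\Delta^2W(x)<0$ for all $x\neq0$, and $\Delta W(x)>0$ for all sufficiently large $|x|$. Let $\rho$ be a compactly supported $d_\infty$-local minimizer of $E$ with center of mass $\int x\,d\rho(x)=0$ such that $\nabla W*\rho$ is continuous, i.e. $\int\nabla W(x-y)\,d\rho(y)$ converges absolutely for almost every $x$ and agrees almost everywhere with a continuous vector field. Then $\rho$ is a global minimizer of $E$ over $\mathcal P_2(\mathbb{R}^d)$, and it is the only one with zero center of mass: if $\sigma\in\mathcal P_2(\mathbb{R}^d)$ has zero center of mass and $E[\sigma]\le E[\rho]$, then $\sigma=\rho$. -/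

import Mathlib

open MeasureTheory Set
open scoped ENNReal

noncomputable section

/-- The space `ℝ^d` with its Euclidean norm. -/
abbrev RSp (d : ℕ) : Type := EuclideanSpace ℝ (Fin d)

/-- The interaction energy `E[ρ] = (1/2) ∫ ∫ W(x - y) dρ(y) dρ(x)` of a potential
`W : ℝ^d → [0, ∞]`. -/
def interactionEnergy {d : ℕ} (W : RSp d → ℝ≥0∞) (ρ : Measure (RSp d)) : ℝ≥0∞ :=
  2⁻¹ * ∫⁻ x, ∫⁻ y, W (x - y) ∂ρ ∂ρ

/-- The real-valued version of `W`. It is only looked at where `W` is finite. -/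
def realPotential {d : ℕ} (W : RSp d → ℝ≥0∞) : RSp d → ℝ := fun x => (W x).toReal

/-- Condition (H) for a potential `W : ℝ^d → [0, ∞]` (which is bounded below by `0`): locally
integrable, lower semicontinuous and symmetric. -/
structure SatisfiesH {d : ℕ} (W : RSp d → ℝ≥0∞) : Prop where
  lsc : LowerSemicontinuous W
  locInt : ∀ K : Set (RSp d), IsCompact K → ∫⁻ x in K, W x < ∞
  symm : ∀ x, W (-x) = W x

/-- Condition (H-s): (H), continuity (either of a finite `W` on `ℝ^d`, or of a finite `W` on
`ℝ^d \ {0}` with `W 0 = ∞`), and the control of the averages of `W` over small balls. -/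
structure SatisfiesHs {d : ℕ} (W : RSp d → ℝ≥0∞) : Prop extends SatisfiesH W where
  cont : (ContinuousOn W {0}ᶜ ∧ (∀ x, x ≠ 0 → W x ≠ ∞) ∧ W 0 = ∞) ∨
    (Continuous W ∧ ∀ x, W x ≠ ∞)
  average_le : ∀ R : ℝ, 0 < R → ∃ C : ℝ, 0 < C ∧ ∀ x : RSp d, ‖x‖ ≤ R →
    ∀ r : ℝ, 0 < r → r ≤ R →
      (volume (Metric.ball x r))⁻¹ * ∫⁻ y in Metric.ball x r, W y ≤ ENNReal.ofReal C * W x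

/-- Membership in `P₂(ℝ^d)`: Borel probability measures with finite second moment. -/
structure IsP2 {d : ℕ} (ρ : Measure (RSp d)) : Prop where
  prob : IsProbabilityMeasure ρ
  second_moment : ∫⁻ x, ‖x‖ₑ ^ 2 ∂ρ < ∞

/-- The center of mass `∫ x dρ(x)`. -/
def centerOfMass {d : ℕ} (ρ : Measure (RSp d)) : RSp d := ∫ x, x ∂ρ

/-- The linear interpolation `(1 - t) ρ₀ + t ρ₁`, for `t ∈ [0, 1]`. -/
def linInterp {d : ℕ} (ρ₀ ρ₁ : Measure (RSp d)) (t : ℝ) : Measure (RSp d) :=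
  ENNReal.ofReal (1 - t) • ρ₀ + ENNReal.ofReal t • ρ₁

/-- Linear interpolation convexity (LIC) of the energy: for any two different measures
`ρ₀, ρ₁ ∈ P₂(ℝ^d)` of finite energy with the same center of mass, `t ↦ E[(1 - t) ρ₀ + t ρ₁]` is a
(finite and) strictly convex function on `[0, 1]`. -/
def IsLIC {d : ℕ} (W : RSp d → ℝ≥0∞) : Prop :=
  ∀ ρ₀ ρ₁ : Measure (RSp d), IsP2 ρ₀ → IsP2 ρ₁ → ρ₀ ≠ ρ₁ →
    interactionEnergy W ρ₀ < ∞ → interactionEnergy W ρ₁ < ∞ →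
    centerOfMass ρ₀ = centerOfMass ρ₁ →
    (∀ t ∈ Icc (0 : ℝ) 1, interactionEnergy W (linInterp ρ₀ ρ₁ t) < ∞) ∧
      StrictConvexOn ℝ (Icc (0 : ℝ) 1)
        (fun t => (interactionEnergy W (linInterp ρ₀ ρ₁ t)).toReal)

/-- Transport plans between `μ` and `ν`: measures on the product with marginals `μ` and `ν`. -/
def transportPlans {d : ℕ} (μ ν : Measure (RSp d)) : Set (Measure (RSp d × RSp d)) :=
  {π | π.map Prod.fst = μ ∧ π.map Prod.snd = ν}

/-- The `∞`-Wasserstein distance `inf_π sup_{(x, y) ∈ supp π} |y - x|`, with values in `[0, ∞]`. -/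
def dInf {d : ℕ} (μ ν : Measure (RSp d)) : ℝ≥0∞ :=
  ⨅ π ∈ transportPlans μ ν, ⨆ p ∈ π.support, edist p.1 p.2

/-- `ρ` is a `d_∞`-local minimizer of the energy among the Borel probability measures. -/
def IsDInfLocalMinimizer {d : ℕ} (W : RSp d → ℝ≥0∞) (ρ : Measure (RSp d)) : Prop :=
  IsProbabilityMeasure ρ ∧ ∃ ε : ℝ, 0 < ε ∧ ∀ σ : Measure (RSp d), IsProbabilityMeasure σ →
    dInf ρ σ < ENNReal.ofReal ε → interactionEnergy W ρ ≤ interactionEnergy W σ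

/-- `ρ` is a global minimizer of the energy over `P₂(ℝ^d)`. -/
def IsGlobalMinimizerP2 {d : ℕ} (W : RSp d → ℝ≥0∞) (ρ : Measure (RSp d)) : Prop :=
  IsP2 ρ ∧ ∀ σ : Measure (RSp d), IsP2 σ → interactionEnergy W ρ ≤ interactionEnergy W σ

/-- Continuity of `∇W * ρ`: the convolution `x ↦ ∫ ∇W(x - y) dρ(y)`, as a function given by an
absolutely convergent integral at almost every `x`, coincides almost everywhere with a continuous
vector field. -/
def GradConvContinuous {d : ℕ} (W : RSp d → ℝ≥0∞) (ρ : Measure (RSp d)) : Prop :=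
  ∃ G : RSp d → RSp d, Continuous G ∧ ∀ᵐ x ∂(volume : Measure (RSp d)),
    Integrable (fun y => gradient (realPotential W) (x - y)) ρ ∧
      ∫ y, gradient (realPotential W) (x - y) ∂ρ = G x

end

/-!
Write `V = W * ρ` for the potential generated by `ρ`. The energy along `(1 - t) ρ + t σ` is a quadratic
polynomial in `t`, and (LIC) says exactly that its second-order coefficient is positive, that is,
`∫ V dσ < E[ρ] + E[σ]` when `σ ≠ ρ` have the same center of mass (`IsLIC.mutualEnergy_lt`). Since
`∫ V dρ = 2 E[ρ]`, both claims follow once `∫ V dρ ≤ ∫ V dσ` for all `σ` (`IsLIC.energy_lt`), and for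
this it suffices that `V` attains its global minimum at every point of the support of `ρ`.

*Regularity.* Because `Δ²W < 0`, the flux `r^(d-1) ∂ᵣW` is bounded below near the origin
(`exists_flux_lower_bound`); together with `W ≥ 0` this makes `∇W` locally integrable. The fundamental
theorem of calculus along almost every segment then gives `V(z + h) - V(z) = ∫₀¹ ⟪G(z + s h), h⟫ ds` for
almost every `z`, where `G` is the continuous representative of `∇W * ρ`. The averages of `V` over
small balls converge to `V` everywhere by the average condition in (H-s), so the identity holds
everywhere (`pot_sub_eq`), and `V` is finite and continuously differentiable.

*Local minimality.* Moving a little mass of `ρ` from near a point `p` of the support to a ball around a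
point `y` at distance less than `ε` shows that `V p ≤ V y` (`pot_le_of_mem_support`). In dimension
`d ≥ 2`, comparing `ρ` with its images under rotations close to the identity, (LIC) forces `ρ` to be
invariant under them (`map_isometry_eq_self`), so `V` and the support are radial.

*Gaps.* Off the support `V` is smooth with `Δ²V < 0`, so along a ray `r^(d-1) ∂ᵣ(ΔV)` is strictly
decreasing, and `ΔV` increases and then decreases on each gap of the support. It cannot be
negative next to an end of the gap, since `∂ᵣV` vanishes and `V` has a local minimum there; hence
`ΔV ≥ 0` on the gap. In a bounded gap this contradicts the vanishing of `r^(d-1) ∂ᵣV` at both ends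
(`no_bounded_gap`), and in an unbounded one, where `ΔV > 0` far out excludes negative values, it makes
`V` increasing (`le_of_unbounded_gap`). So the support meets each ray in an interval, on which `V` is
constant, and `V` grows outside (`IsSupportPotential.le`). In dimension one the same argument works on
the line, without any symmetry of `ρ`.
-/

noncomputable section

open Filter Topology Laplacian InnerProductSpace

/-! ### One-dimensional comparison arguments -/

/-- A function `u` for which `m u'` is strictly decreasing, `m > 0`, increases and then decreases.
So `u` is nonnegative on the interval `I` as soon as it is not negative next to an endpoint. -/
theorem nonneg_of_strictAntiOn_mul_deriv {I : Set ℝ} (hc : I.OrdConnected)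
    {m u u' : ℝ → ℝ} (hm : ∀ r ∈ I, 0 < m r) (hu : ∀ r ∈ I, HasDerivAt u (u' r) r)
    (hz : StrictAntiOn (fun r => m r * u' r) I)
    (hl : ∀ c ∈ I, ¬ ∀ r ∈ I, r < c → u r < 0 ∧ 0 < m r * u' r)
    (hr : ∀ c ∈ I, ¬ ∀ r ∈ I, c < r → u r < 0) : ∀ r ∈ I, 0 ≤ u r := by
  intro s hs
  by_contra! hneg
  rcases le_or_gt 0 (m s * u' s) with h0 | h0
  · refine hl s hs fun r hrI hrs => ⟨?_, h0.trans_lt (hz hrI hs hrs)⟩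
    have hsub : Icc r s ⊆ I := hc.out hrI hs
    have hmono : MonotoneOn u (Icc r s) := by
      refine monotoneOn_of_deriv_nonneg (convex_Icc r s)
        (fun x hx => (hu x (hsub hx)).continuousAt.continuousWithinAt)
        (fun x hx => (hu x (hsub (interior_subset hx))).differentiableAt.differentiableWithinAt) ?_
      intro x hx
      have hxI := hsub (interior_subset hx)
      rw [interior_Icc] at hx
      rw [(hu x hxI).deriv]
      exact (pos_of_mul_pos_right (h0.trans_lt (hz hxI hs hx.2)) (hm x hxI).le).le
    exact (hmono (left_mem_Icc.2 hrs.le) (right_mem_Icc.2 hrs.le) hrs.le).trans_lt hneg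
  · refine hr s hs fun r hrI hrs => ?_
    have hsub : Icc s r ⊆ I := hc.out hs hrI
    have hmono : AntitoneOn u (Icc s r) := by
      refine antitoneOn_of_deriv_nonpos (convex_Icc s r)
        (fun x hx => (hu x (hsub hx)).continuousAt.continuousWithinAt)
        (fun x hx => (hu x (hsub (interior_subset hx))).differentiableAt.differentiableWithinAt) ?_
      intro x hx
      have hxI := hsub (interior_subset hx)
      rw [interior_Icc] at hx
      rw [(hu x hxI).deriv]
      have h1 : m x * u' x < 0 := (hz hs hxI hx.1).trans h0
      by_contra! h2
      exact absurd (mul_pos (hm x hxI) h2) (not_lt.2 h1.le)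
    exact (hmono (left_mem_Icc.2 hrs.le) (right_mem_Icc.2 hrs.le) hrs.le).trans_lt hneg

/-- If the flux `m v'` vanishes at the left end `a` and `(m v')' < 0` next to `a`, then `v` does not
have a local minimum at `a`. -/
theorem not_neg_near_left {a c : ℝ} (hac : a < c) {m v v' u : ℝ → ℝ}
    (hm : ∀ r ∈ Ioo a c, 0 < m r) (hv : ∀ r ∈ Ioo a c, HasDerivAt v (v' r) r)
    (hvc : ContinuousOn v (Ico a c)) (hwc : ContinuousOn (fun r => m r * v' r) (Ico a c))
    (hw : ∀ r ∈ Ioo a c, HasDerivAt (fun r => m r * v' r) (m r * u r) r)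
    (hwa : m a * v' a = 0) (hmin : ∃ δ > 0, ∀ r ∈ Ioo a (a + δ), v a ≤ v r)
    (hneg : ∀ r ∈ Ioo a c, u r < 0) : False := by
  have hint : interior (Ico a c) = Ioo a c := interior_Ico
  have hwanti : StrictAntiOn (fun r => m r * v' r) (Ico a c) := by
    refine strictAntiOn_of_deriv_neg (convex_Ico a c) hwc ?_
    intro x hx
    rw [hint] at hx
    rw [(hw x hx).deriv]
    exact mul_neg_of_pos_of_neg (hm x hx) (hneg x hx)
  have hvanti : StrictAntiOn v (Ico a c) := by
    refine strictAntiOn_of_deriv_neg (convex_Ico a c) hvc ?_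
    intro x hx
    rw [hint] at hx
    rw [(hv x hx).deriv]
    have h1 : m x * v' x < 0 := by
      have := hwanti (left_mem_Ico.2 hac) (Ioo_subset_Ico_self hx) hx.1
      simpa only [hwa] using this
    by_contra! h2
    exact absurd (mul_nonneg (hm x hx).le h2) (not_le.2 h1)
  obtain ⟨δ, hδ, hδ'⟩ := hmin
  have hr : a < min (a + δ / 2) ((a + c) / 2) := by
    rw [lt_min_iff]; constructor <;> linarith
  have h1 := min_le_left (a + δ / 2) ((a + c) / 2)
  have h2 := min_le_right (a + δ / 2) ((a + c) / 2)
  refine absurd (hδ' _ ⟨hr, by linarith⟩) (not_le.2 ?_)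
  exact hvanti (left_mem_Ico.2 hac) ⟨hr.le, by linarith⟩ hr

/-- The mirror image of `not_neg_near_left`. -/
theorem not_neg_near_right {c b : ℝ} (hcb : c < b) {m v v' u : ℝ → ℝ}
    (hm : ∀ r ∈ Ioo c b, 0 < m r) (hv : ∀ r ∈ Ioo c b, HasDerivAt v (v' r) r)
    (hvc : ContinuousOn v (Ioc c b)) (hwc : ContinuousOn (fun r => m r * v' r) (Ioc c b))
    (hw : ∀ r ∈ Ioo c b, HasDerivAt (fun r => m r * v' r) (m r * u r) r)
    (hwb : m b * v' b = 0) (hmin : ∃ δ > 0, ∀ r ∈ Ioo (b - δ) b, v b ≤ v r)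
    (hneg : ∀ r ∈ Ioo c b, u r < 0) : False := by
  have hint : interior (Ioc c b) = Ioo c b := interior_Ioc
  have hwanti : StrictAntiOn (fun r => m r * v' r) (Ioc c b) := by
    refine strictAntiOn_of_deriv_neg (convex_Ioc c b) hwc ?_
    intro x hx
    rw [hint] at hx
    rw [(hw x hx).deriv]
    exact mul_neg_of_pos_of_neg (hm x hx) (hneg x hx)
  have hvmono : StrictMonoOn v (Ioc c b) := by
    refine strictMonoOn_of_deriv_pos (convex_Ioc c b) hvc ?_
    intro x hx
    rw [hint] at hx
    rw [(hv x hx).deriv]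
    have h1 : 0 < m x * v' x := by
      have := hwanti (Ioo_subset_Ioc_self hx) (right_mem_Ioc.2 hcb) hx.2
      simpa only [hwb] using this
    exact pos_of_mul_pos_right h1 (hm x hx).le
  obtain ⟨δ, hδ, hδ'⟩ := hmin
  have hr : max (b - δ / 2) ((b + c) / 2) < b := by
    rw [max_lt_iff]; constructor <;> linarith
  have h1 := le_max_left (b - δ / 2) ((b + c) / 2)
  have h2 := le_max_right (b - δ / 2) ((b + c) / 2)
  refine absurd (hδ' _ ⟨by linarith, hr⟩) (not_le.2 ?_)
  exact hvmono ⟨by linarith, hr.le⟩ (right_mem_Ioc.2 hcb) hr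

/-- There is no bounded gap `(a, b)` on which `m ((m v')' / m)'` is strictly decreasing and at whose
ends the flux `m v'` vanishes and `v` has local minima. At the left end, the local minimum can be
replaced by a sign of `m u'`. -/
theorem no_bounded_gap {a b : ℝ} (hab : a < b) {m v v' u u' : ℝ → ℝ}
    (hm : ∀ r ∈ Ioo a b, 0 < m r) (hv : ∀ r ∈ Ioo a b, HasDerivAt v (v' r) r)
    (hvc : ContinuousOn v (Icc a b)) (hwc : ContinuousOn (fun r => m r * v' r) (Icc a b))
    (hw : ∀ r ∈ Ioo a b, HasDerivAt (fun r => m r * v' r) (m r * u r) r)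
    (hu : ∀ r ∈ Ioo a b, HasDerivAt u (u' r) r)
    (hz : StrictAntiOn (fun r => m r * u' r) (Ioo a b))
    (hwa : m a * v' a = 0) (hwb : m b * v' b = 0)
    (hmina : (∃ δ > 0, ∀ r ∈ Ioo a (a + δ), v a ≤ v r) ∨ ∀ r ∈ Ioo a b, m r * u' r ≤ 0)
    (hminb : ∃ δ > 0, ∀ r ∈ Ioo (b - δ) b, v b ≤ v r) : False := by
  have hu0 : ∀ r ∈ Ioo a b, 0 ≤ u r := by
    refine nonneg_of_strictAntiOn_mul_deriv ordConnected_Ioo hm hu hz ?_ ?_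
    · intro c hc hneg
      rcases hmina with hmina | hmina
      · have hsub : Ioo a c ⊆ Ioo a b := Ioo_subset_Ioo le_rfl hc.2.le
        have hsub' : Ico a c ⊆ Icc a b := fun x hx => ⟨hx.1, (hx.2.trans hc.2).le⟩
        exact not_neg_near_left hc.1 (fun r hr => hm r (hsub hr)) (fun r hr => hv r (hsub hr))
          (hvc.mono hsub') (hwc.mono hsub') (fun r hr => hw r (hsub hr)) hwa hmina
          (fun r hr => (hneg r (hsub hr) hr.2).1)
      · obtain ⟨r, hr⟩ := exists_between hc.1
        have hrI : r ∈ Ioo a b := ⟨hr.1, hr.2.trans hc.2⟩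
        exact absurd (hneg r hrI hr.2).2 (not_lt.2 (hmina r hrI))
    · intro c hc hneg
      have hsub : Ioo c b ⊆ Ioo a b := Ioo_subset_Ioo hc.1.le le_rfl
      have hsub' : Ioc c b ⊆ Icc a b := fun x hx => ⟨(hc.1.trans hx.1).le, hx.2⟩
      exact not_neg_near_right hc.2 (fun r hr => hm r (hsub hr)) (fun r hr => hv r (hsub hr))
          (hvc.mono hsub') (hwc.mono hsub') (fun r hr => hw r (hsub hr)) hwb hminb
          (fun r hr => hneg r (hsub hr) hr.1)
  -- The flux is monotone and vanishes at both ends, so it vanishes, and with it `u` and `m u'`.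
  have hmono : MonotoneOn (fun r => m r * v' r) (Icc a b) := by
    refine monotoneOn_of_deriv_nonneg (convex_Icc a b) hwc ?_ ?_
    · intro x hx
      rw [interior_Icc] at hx
      exact (hw x hx).differentiableAt.differentiableWithinAt
    · intro x hx
      rw [interior_Icc] at hx
      rw [(hw x hx).deriv]
      exact mul_nonneg (hm x hx).le (hu0 x hx)
  have hw0 : ∀ r ∈ Ioo a b, m r * v' r = 0 := by
    intro r hr
    have h1 := hmono (left_mem_Icc.2 hab.le) (Ioo_subset_Icc_self hr) hr.1.le
    have h2 := hmono (Ioo_subset_Icc_self hr) (right_mem_Icc.2 hab.le) hr.2.le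
    simp only [hwa, hwb] at h1 h2
    exact le_antisymm h2 h1
  have hnhds : ∀ r ∈ Ioo a b, Ioo a b ∈ nhds r := fun r hr => isOpen_Ioo.mem_nhds hr
  have hu00 : ∀ r ∈ Ioo a b, u r = 0 := by
    intro r hr
    have h1 : HasDerivAt (fun r => m r * v' r) 0 r :=
      (hasDerivAt_const r (0 : ℝ)).congr_of_eventuallyEq
        (Filter.eventually_of_mem (hnhds r hr) hw0)
    have h2 := (hw r hr).unique h1
    exact (mul_eq_zero.1 h2).resolve_left (hm r hr).ne'
  have hu'0 : ∀ r ∈ Ioo a b, u' r = 0 := by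
    intro r hr
    have h1 : HasDerivAt u 0 r :=
      (hasDerivAt_const r (0 : ℝ)).congr_of_eventuallyEq
        (Filter.eventually_of_mem (hnhds r hr) hu00)
    exact (hu r hr).unique h1
  obtain ⟨s, hs⟩ := exists_between hab
  obtain ⟨t, ht⟩ := exists_between hs.2
  have htI : t ∈ Ioo a b := ⟨hs.1.trans ht.1, ht.2⟩
  have := hz hs htI ht.1
  simp [hu'0 s hs, hu'0 t htI] at this

/-- On an unbounded gap `(a, ∞)` with `u > 0` far out, the function `v` stays above `v a`. -/
theorem le_of_unbounded_gap {a : ℝ} {m v v' u u' : ℝ → ℝ}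
    (hm : ∀ r ∈ Ioi a, 0 < m r) (hv : ∀ r ∈ Ioi a, HasDerivAt v (v' r) r)
    (hvc : ContinuousOn v (Ici a)) (hwc : ContinuousOn (fun r => m r * v' r) (Ici a))
    (hw : ∀ r ∈ Ioi a, HasDerivAt (fun r => m r * v' r) (m r * u r) r)
    (hu : ∀ r ∈ Ioi a, HasDerivAt u (u' r) r)
    (hz : StrictAntiOn (fun r => m r * u' r) (Ioi a))
    (hwa : m a * v' a = 0)
    (hmina : ∃ δ > 0, ∀ r ∈ Ioo a (a + δ), v a ≤ v r)
    (hfar : ∃ R, ∀ r, R < r → 0 < u r) : ∀ r ∈ Ici a, v a ≤ v r := by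
  have hu0 : ∀ r ∈ Ioi a, 0 ≤ u r := by
    refine nonneg_of_strictAntiOn_mul_deriv ordConnected_Ioi hm hu hz ?_ ?_
    · intro c hc hneg
      have hsub : Ioo a c ⊆ Ioi a := fun x hx => hx.1
      have hsub' : Ico a c ⊆ Ici a := fun x hx => hx.1
      exact not_neg_near_left hc (fun r hr => hm r (hsub hr)) (fun r hr => hv r (hsub hr))
          (hvc.mono hsub') (hwc.mono hsub') (fun r hr => hw r (hsub hr)) hwa hmina
          (fun r hr => (hneg r (hsub hr) hr.2).1)
    · intro c hc hneg
      obtain ⟨R, hR⟩ := hfar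
      have h1 : c < max c R + 1 := (le_max_left c R).trans_lt (lt_add_one _)
      have h2 : R < max c R + 1 := (le_max_right c R).trans_lt (lt_add_one _)
      exact absurd (hneg _ (mem_Ioi.2 ((mem_Ioi.1 hc).trans h1)) h1) (not_lt.2 (hR _ h2).le)
  have hmono : MonotoneOn (fun r => m r * v' r) (Ici a) := by
    refine monotoneOn_of_deriv_nonneg (convex_Ici a) hwc ?_ ?_
    · intro x hx
      rw [interior_Ici] at hx
      exact (hw x hx).differentiableAt.differentiableWithinAt
    · intro x hx
      rw [interior_Ici] at hx
      rw [(hw x hx).deriv]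
      exact mul_nonneg (hm x hx).le (hu0 x hx)
  have hvmono : MonotoneOn v (Ici a) := by
    refine monotoneOn_of_deriv_nonneg (convex_Ici a) hvc ?_ ?_
    · intro x hx
      rw [interior_Ici] at hx
      exact (hv x hx).differentiableAt.differentiableWithinAt
    · intro x hx
      rw [interior_Ici] at hx
      rw [(hv x hx).deriv]
      have h1 := hmono self_mem_Ici (mem_Ici_of_Ioi hx) (le_of_lt hx)
      simp only [hwa] at h1
      exact nonneg_of_mul_nonneg_right h1 (hm x hx)
  exact fun r hr => hvmono self_mem_Ici hr hr

/-- If `rⁿ u'` is decreasing, where `rⁿ u = (rⁿ w')'`, then `rⁿ w'` is bounded below near `0`: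
integrate the lower bound for `u'` twice. -/
theorem exists_flux_lower_bound {n : ℕ} {w' u u' : ℝ → ℝ}
    (hw : ∀ r ∈ Ioi (0 : ℝ), HasDerivAt (fun r => r ^ n * w' r) (r ^ n * u r) r)
    (hu : ∀ r ∈ Ioi (0 : ℝ), HasDerivAt u (u' r) r)
    (hz : StrictAntiOn (fun r => r ^ n * u' r) (Ioi 0)) {K : ℝ} (hK : 0 < K) :
    ∃ C, ∀ r ∈ Ioc 0 K, -C ≤ r ^ n * w' r := by
  set c := |K ^ n * u' K| with hc
  set C₁ := K ^ n * |u K| + c * K with hC₁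
  have hc0 : 0 ≤ c := abs_nonneg _
  have hC₁0 : 0 ≤ C₁ := by positivity
  have hu1 : ∀ r ∈ Ioc 0 K, r ^ n * u r ≤ C₁ := by
    intro r hr
    rcases hr.2.eq_or_lt with rfl | hrK
    · have : r ^ n * u r ≤ r ^ n * |u r| :=
        mul_le_mul_of_nonneg_left (le_abs_self _) (pow_nonneg hK.le n)
      nlinarith [mul_nonneg hc0 hK.le]
    -- The slope of `u` on `[r, K]` is `u' ξ ≥ -c ξ⁻ⁿ ≥ -c r⁻ⁿ`, so the loss is compensated by `rⁿ`.
    obtain ⟨ξ, hξ, hξ'⟩ := exists_hasDerivAt_eq_slope u u' hrK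
      (fun x hx => (hu x (hr.1.trans_le hx.1)).continuousAt.continuousWithinAt)
      (fun x hx => hu x (hr.1.trans hx.1))
    have hξ0 : 0 < ξ := hr.1.trans hξ.1
    have h1 : -c ≤ ξ ^ n * u' ξ :=
      (neg_abs_le _).trans (hz (mem_Ioi.2 hξ0) (mem_Ioi.2 hK) hξ.2).le
    have h2 : -c ≤ r ^ n * u' ξ := by
      rcases le_or_gt 0 (u' ξ) with h | h
      · have := mul_nonneg (pow_nonneg hr.1.le n) h
        linarith
      · have : r ^ n ≤ ξ ^ n := pow_le_pow_left₀ hr.1.le hξ.1.le n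
        nlinarith
    rw [eq_div_iff (by linarith [hrK] : K - r ≠ 0)] at hξ'
    have h3 : r ^ n * u r = r ^ n * u K - r ^ n * u' ξ * (K - r) := by rw [mul_assoc, hξ']; ring
    have h4 : r ^ n * u K ≤ K ^ n * |u K| :=
      (mul_le_mul_of_nonneg_left (le_abs_self _) (pow_nonneg hr.1.le n)).trans
        (mul_le_mul_of_nonneg_right (pow_le_pow_left₀ hr.1.le hr.2 n) (abs_nonneg _))
    have h5 : -(r ^ n * u' ξ) * (K - r) ≤ c * K :=
      (mul_le_mul_of_nonneg_right (by linarith) (by linarith)).trans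
        (mul_le_mul_of_nonneg_left (by linarith [hr.1]) hc0)
    rw [h3]; linarith
  refine ⟨C₁ * K + |K ^ n * w' K|, fun r hr => ?_⟩
  rcases hr.2.eq_or_lt with rfl | hrK
  · have := neg_abs_le (r ^ n * w' r)
    nlinarith [mul_nonneg hC₁0 hK.le]
  obtain ⟨ξ, hξ, hξ'⟩ := exists_hasDerivAt_eq_slope (fun r => r ^ n * w' r) (fun r => r ^ n * u r)
    hrK (fun x hx => (hw x (hr.1.trans_le hx.1)).continuousAt.continuousWithinAt)
    (fun x hx => hw x (hr.1.trans hx.1))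
  rw [eq_div_iff (by linarith [hrK] : K - r ≠ 0)] at hξ'
  have h1 := hu1 ξ ⟨hr.1.trans hξ.1, hξ.2.le⟩
  have h2 : ξ ^ n * u ξ * (K - r) ≤ C₁ * K :=
    (mul_le_mul_of_nonneg_right h1 (by linarith)).trans
        (mul_le_mul_of_nonneg_left (by linarith [hr.1]) hC₁0)
  have := neg_abs_le (K ^ n * w' K)
  linarith

/-- If moreover `w ≥ 0`, then `rⁿ w'` is integrable near `0`, since `rⁿ w' ≤ (rⁿ w)'`. -/
theorem integrableOn_flux {n : ℕ} {w w' u : ℝ → ℝ} (hw0 : ∀ r ∈ Ioi (0 : ℝ), 0 ≤ w r)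
    (hw' : ∀ r ∈ Ioi (0 : ℝ), HasDerivAt w (w' r) r)
    (hw : ∀ r ∈ Ioi (0 : ℝ), HasDerivAt (fun r => r ^ n * w' r) (r ^ n * u r) r)
    {K : ℝ} (hK : 0 < K) {C : ℝ} (hC : ∀ r ∈ Ioc 0 K, -C ≤ r ^ n * w' r) :
    IntegrableOn (fun r => r ^ n * w' r) (Ioc 0 K) := by
  have hcw : ContinuousOn (fun r => r ^ n * w' r) (Ioi 0) :=
    fun r hr => (hw r hr).continuousAt.continuousWithinAt
  have hcw0 : ContinuousOn w (Ioi 0) := fun r hr => (hw' r hr).continuousAt.continuousWithinAt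
  have hsub : ∀ δ > 0, uIcc δ K ⊆ Ioi (0 : ℝ) := fun δ hδ x hx =>
    (lt_min hδ hK).trans_le hx.1
  set D : ℝ → ℝ := fun r => n * r ^ (n - 1) * w r + r ^ n * w' r with hD
  have hDc : ContinuousOn D (Ioi 0) := by
    apply ContinuousOn.add _ hcw
    exact ContinuousOn.mul (by fun_prop) hcw0
  have hP : ∀ r ∈ Ioi (0 : ℝ), HasDerivAt (fun r => r ^ n * w r) (D r) r := by
    intro r hr
    exact (hasDerivAt_pow n r).mul (hw' r hr)
  -- The function `rⁿ w' + C` is nonnegative, so bounds on its integrals over `[a k, K]` suffice.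
  have hint : IntegrableOn (fun r => r ^ n * w' r + C) (Ioc 0 K) := by
    set a : ℕ → ℝ := fun k => K / (k + 2) with ha
    have hapos : ∀ k, 0 < a k := fun k => by positivity
    have haK : ∀ k, a k ≤ K := fun k => div_le_self hK.le (by linarith [Nat.cast_nonneg (α := ℝ) k])
    have hat : Filter.Tendsto a Filter.atTop (nhds 0) :=
      tendsto_const_nhds.div_atTop
        (Filter.tendsto_atTop_add_const_right _ _ tendsto_natCast_atTop_atTop)
    refine integrableOn_Ioc_of_intervalIntegral_norm_bounded_left (l := Filter.atTop) (a := a)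
      (I := K ^ n * w K + |C| * K) (fun k => ?_) hat (Filter.Eventually.of_forall fun k => ?_)
    · refine (ContinuousOn.integrableOn_Icc ?_).mono_set Ioc_subset_Icc_self
      exact (hcw.mono fun x hx => (hapos k).trans_le hx.1).add continuousOn_const
    · rw [← intervalIntegral.integral_of_le (haK k)]
      have hci : ∀ f : ℝ → ℝ, ContinuousOn f (Ioi 0) → IntervalIntegrable f volume (a k) K :=
        fun f hf => (hf.mono (hsub _ (hapos k))).intervalIntegrable
      calc ∫ x in a k..K, ‖x ^ n * w' x + C‖
          ≤ ∫ x in a k..K, (D x + |C|) := by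
            refine intervalIntegral.integral_mono_on (haK k)
              (hci _ (hcw.add continuousOn_const).norm) (hci _ (hDc.add continuousOn_const)) ?_
            intro x hx
            have hx0 : 0 < x := (hapos k).trans_le hx.1
            rw [Real.norm_of_nonneg (by linarith [hC x ⟨hx0, hx.2⟩])]
            have h1 : 0 ≤ n * x ^ (n - 1) * w x := by
              have := hw0 x hx0
              positivity
            simp only [hD]
            linarith [le_abs_self C]
        _ = (K ^ n * w K - a k ^ n * w (a k)) + |C| * (K - a k) := by
            rw [intervalIntegral.integral_add (hci _ hDc) (hci _ continuousOn_const),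
              intervalIntegral.integral_eq_sub_of_hasDerivAt
                (fun x hx => hP x (hsub _ (hapos k) hx)) (hci _ hDc)]
            simp; ring
        _ ≤ _ := by
            have h1 : 0 ≤ a k ^ n * w (a k) := by
              have h2 := hw0 _ (hapos k)
              have h3 := hapos k
              positivity
            have h2 := mul_nonneg (abs_nonneg C) (hapos k).le
            nlinarith
  have hsub' := hint.sub (integrableOn_const (C := C) (by simp) (by simp))
  refine hsub'.congr (Filter.Eventually.of_forall fun r => ?_)
  simp

/-! ### The Laplacian along rays -/

theorem laplacian_eq_sum_fderiv {d : ℕ} (f : RSp d → ℝ) (b : OrthonormalBasis (Fin d) ℝ (RSp d))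
    (x : RSp d) : Δ f x = ∑ i, fderiv ℝ (fderiv ℝ f) x (b i) (b i) := by
  rw [laplacian_eq_iteratedFDeriv_orthonormalBasis f b]
  simp [iteratedFDeriv_two_apply]

theorem contDiffAt_laplacian {d : ℕ} {f : RSp d → ℝ} {x : RSp d} {n m : WithTop ℕ∞}
    (hf : ContDiffAt ℝ m f x) (hmn : n + 2 ≤ m) : ContDiffAt ℝ n (Δ f) x := by
  rw [laplacian_eq_iteratedFDeriv_stdOrthonormalBasis f]
  refine ContDiffAt.sum fun i _ => ?_
  have h1 : ContDiffAt ℝ n (iteratedFDeriv ℝ 2 f) x := hf.iteratedFDeriv_right (by exact_mod_cast hmn)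
  exact ((ContinuousMultilinearMap.apply ℝ (fun _ : Fin 2 => RSp d) ℝ _).contDiff.contDiffAt).comp
    x h1

/-- The Laplacian of a radial function is radial. -/
theorem laplacian_radial {d : ℕ} {f : RSp d → ℝ} (hf : ∀ x y, ‖x‖ = ‖y‖ → f x = f y)
    (x y : RSp d) (hxy : ‖x‖ = ‖y‖) : Δ f x = Δ f y := by
  set R := Submodule.reflection (ℝ ∙ (x - y))ᗮ with hR
  have hRx : R x = y := Submodule.reflection_sub hxy
  have hcomp : f ∘ R = f := funext fun z => hf _ _ (R.norm_map z)
  set b := EuclideanSpace.basisFun (Fin d) ℝ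
  rw [congrFun (laplacian_eq_iteratedFDeriv_orthonormalBasis f b) x,
    congrFun (laplacian_eq_iteratedFDeriv_orthonormalBasis f (b.map R)) y]
  refine Finset.sum_congr rfl fun i _ => ?_
  have h := ContinuousLinearEquiv.iteratedFDerivWithin_comp_right
    (R.toContinuousLinearEquiv) f (s := univ) uniqueDiffOn_univ (x := x) (mem_univ _) 2
  have hcomp' : f ∘ R.toContinuousLinearEquiv = f := hcomp
  rw [hcomp', preimage_univ] at h
  simp only [iteratedFDerivWithin_univ] at h
  rw [h, ContinuousMultilinearMap.compContinuousLinearMap_apply]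
  have : R.toContinuousLinearEquiv x = y := hRx
  rw [this]
  congr 1
  ext j
  fin_cases j <;> rfl

/-- The tangential second derivatives of a radial function, from differentiating twice along a
circle. -/
theorem fderiv_fderiv_tangential {d : ℕ} {f : RSp d → ℝ} (hf : ∀ x y, ‖x‖ = ‖y‖ → f x = f y)
    {r : ℝ} {e e' : RSp d} (he : ‖e‖ = 1) (he' : ‖e'‖ = 1) (hee : inner ℝ e e' = 0)
    (hC : ContDiffAt ℝ 2 f (r • e)) :
    r * r * fderiv ℝ (fderiv ℝ f) (r • e) e' e' = r * fderiv ℝ f (r • e) e := by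
  -- The circle of radius `r` in the plane of `e` and `e'`, on which `f` is constant.
  set γ : ℝ → RSp d := fun θ => (r * Real.cos θ) • e + (r * Real.sin θ) • e' with hγ
  set γ' : ℝ → RSp d := fun θ => (r * -Real.sin θ) • e + (r * Real.cos θ) • e' with hγ'
  have hγ0 : γ 0 = r • e := by simp [hγ]
  have hd : ∀ θ, HasDerivAt γ (γ' θ) θ := fun θ =>
    (((Real.hasDerivAt_cos θ).const_mul r).smul_const e).add
      (((Real.hasDerivAt_sin θ).const_mul r).smul_const e')
  have hd' : HasDerivAt γ' ((r * -1) • e + (r * 0) • e') 0 := by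
    have h1 := (((Real.hasDerivAt_sin 0).neg.const_mul r).smul_const e).add
      (((Real.hasDerivAt_cos 0).const_mul r).smul_const e')
    rw [Real.cos_zero] at h1
    simp only [Real.sin_zero, neg_zero] at h1
    rw [mul_zero] at h1 ⊢
    exact h1
  have hnorm : ∀ θ, ‖γ θ‖ = ‖r • e‖ := by
    intro θ
    have h1 : ‖γ θ‖ ^ 2 = ‖r • e‖ ^ 2 := by
      simp only [hγ]
      rw [norm_add_sq_real, norm_smul, norm_smul, norm_smul, inner_smul_left, inner_smul_right, hee,
        he, he']
      simp only [mul_one, mul_zero, add_zero, Real.norm_eq_abs, sq_abs]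
      linear_combination r ^ 2 * Real.sin_sq_add_cos_sq θ
    exact (pow_left_inj₀ (norm_nonneg _) (norm_nonneg _) two_ne_zero).1 h1
  have hγc : ContinuousAt γ 0 := (hd 0).continuousAt
  have hdiff : ∀ᶠ θ in 𝓝 (0 : ℝ), DifferentiableAt ℝ f (γ θ) := by
    have h1 : ∀ᶠ y in 𝓝 (r • e), ContDiffAt ℝ 2 f y := hC.eventually (by simp)
    rw [← hγ0] at h1
    exact (hγc.eventually h1).mono fun θ hθ => hθ.differentiableAt (by simp)
  have hzero : (fun θ => fderiv ℝ f (γ θ) (γ' θ)) =ᶠ[𝓝 0] fun _ => (0 : ℝ) := by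
    filter_upwards [hdiff] with θ hθ
    have h1 := hθ.hasFDerivAt.comp_hasDerivAt θ (hd θ)
    have h2 : (f ∘ γ) = fun _ => f (r • e) := funext fun θ => hf _ _ (hnorm θ)
    rw [h2] at h1
    exact h1.unique (hasDerivAt_const _ _)
  have hC1 : DifferentiableAt ℝ (fderiv ℝ f) (r • e) :=
    (hC.fderiv_right (m := 1) (by norm_num)).differentiableAt (by simp)
  have hD : HasDerivAt (fun θ => fderiv ℝ f (γ θ)) (fderiv ℝ (fderiv ℝ f) (r • e) (γ' 0)) 0 := by
    have h1 : HasFDerivAt (fderiv ℝ f) (fderiv ℝ (fderiv ℝ f) (r • e)) (γ 0) := by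
      rw [hγ0]; exact hC1.hasFDerivAt
    exact h1.comp_hasDerivAt (0 : ℝ) (hd 0)
  have h := hD.clm_apply hd'
  have h0 := h.unique ((hasDerivAt_const (0 : ℝ) (0 : ℝ)).congr_of_eventuallyEq hzero)
  have hγ'0 : γ' 0 = r • e' := by simp [hγ']
  rw [hγ'0, hγ0] at h0
  simp only [map_smul, smul_apply, smul_eq_mul, mul_neg, mul_one, mul_zero,
    zero_smul, add_zero, neg_smul, map_neg] at h0
  linarith

/-- The Laplacian in polar coordinates, in divergence form: `(r^(d-1) φ')' = r^(d-1) Δ f` for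
`φ r = f (r e)`. In dimension one this needs no symmetry of `f`. -/
theorem hasDerivAt_flux {d : ℕ} {f : RSp d → ℝ} {r : ℝ} {e : RSp d} (he : ‖e‖ = 1)
    (hC : ContDiffAt ℝ 2 f (r • e))
    (hrad : d = 1 ∨ (0 < r ∧ ∀ x y, ‖x‖ = ‖y‖ → f x = f y)) :
    HasDerivAt (fun s : ℝ => s ^ (d - 1) * fderiv ℝ f (s • e) e)
      (r ^ (d - 1) * Δ f (r • e)) r := by
  have hd : 0 < d := by
    rcases Nat.eq_zero_or_pos d with rfl | h
    · have : e = 0 := Subsingleton.elim _ _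
      simp [this] at he
    · exact h
  have hC1 : DifferentiableAt ℝ (fderiv ℝ f) (r • e) :=
    (hC.fderiv_right (m := 1) (by norm_num)).differentiableAt (by simp)
  have hray : HasDerivAt (fun s : ℝ => s • e) e r := by
    simpa using (hasDerivAt_id r).smul_const e
  have hD : HasDerivAt (fun s : ℝ => fderiv ℝ f (s • e) e)
      (fderiv ℝ (fderiv ℝ f) (r • e) e e) r := by
    have h1 := hC1.hasFDerivAt.comp_hasDerivAt r hray
    simpa using h1.clm_apply (hasDerivAt_const r e)
  have h := (hasDerivAt_pow (d - 1) r).mul hD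
  refine h.congr_deriv ?_
  obtain ⟨b, hb⟩ := Orthonormal.exists_orthonormalBasis_extension_of_card_eq (𝕜 := ℝ)
    (ι := Fin d) (E := RSp d) (by simp) (v := fun _ => e) (s := {⟨0, hd⟩})
    (by
      rw [orthonormal_subsingleton_iff]
      intro i; simpa using he)
  have hb0 : b ⟨0, hd⟩ = e := hb _ rfl
  rw [laplacian_eq_sum_fderiv f b, ← Finset.add_sum_erase _ _ (Finset.mem_univ (⟨0, hd⟩ : Fin d)),
    hb0, mul_add, add_comm]
  congr 1
  rcases hrad with rfl | ⟨hr, hrad⟩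
  · have : (Finset.univ : Finset (Fin 1)).erase ⟨0, hd⟩ = ∅ :=
      Finset.card_eq_zero.1 (by simp)
    rw [this]; simp
  · have hterm : ∀ i ∈ (Finset.univ : Finset (Fin d)).erase ⟨0, hd⟩,
        fderiv ℝ (fderiv ℝ f) (r • e) (b i) (b i) = r⁻¹ * fderiv ℝ f (r • e) e := by
      intro i hi
      have hne : (⟨0, hd⟩ : Fin d) ≠ i := (Finset.ne_of_mem_erase hi).symm
      have h1 := fderiv_fderiv_tangential hrad he (b.norm_eq_one i)
        (by rw [← hb0]; exact b.inner_eq_zero hne) hC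
      field_simp
      have h2 : r * (r * fderiv ℝ (fderiv ℝ f) (r • e) (b i) (b i)) = r * fderiv ℝ f (r • e) e := by
        linarith
      linarith [mul_left_cancel₀ hr.ne' h2]
    rw [Finset.sum_congr rfl hterm, Finset.sum_const, Finset.card_erase_of_mem (Finset.mem_univ _),
      Finset.card_univ, Fintype.card_fin, nsmul_eq_mul]
    rcases Nat.eq_zero_or_pos (d - 1) with h0 | h0
    · rw [h0]; simp
    · have : r ^ (d - 1) = r ^ (d - 1 - 1) * r := by
        rw [← pow_succ]; congr 1; omega
      rw [this]; field_simp

theorem hasDerivAt_ray {d : ℕ} {f : RSp d → ℝ} {r : ℝ} {e : RSp d}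
    (hf : DifferentiableAt ℝ f (r • e)) :
    HasDerivAt (fun s : ℝ => f (s • e)) (fderiv ℝ f (r • e) e) r := by
  have hray : HasDerivAt (fun s : ℝ => s • e) e r := by
    simpa using (hasDerivAt_id r).smul_const e
  exact hf.hasFDerivAt.comp_hasDerivAt r hray

/-- A strictly negative bi-Laplacian makes the flux `r^(d-1) ∂ᵣ Δf` strictly decreasing. -/
theorem strictAntiOn_flux_laplacian {d : ℕ} {f : RSp d → ℝ} {e : RSp d} (he : ‖e‖ = 1)
    {I : Set ℝ} (hI : IsOpen I) (hc : Convex ℝ I) (hC : ∀ r ∈ I, ContDiffAt ℝ 4 f (r • e))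
    (hrad : d = 1 ∨ ((∀ r ∈ I, 0 < r) ∧ ∀ x y, ‖x‖ = ‖y‖ → f x = f y))
    (hpos : ∀ r ∈ I, 0 < r ^ (d - 1)) (hneg : ∀ r ∈ I, Δ (Δ f) (r • e) < 0) :
    StrictAntiOn (fun r : ℝ => r ^ (d - 1) * fderiv ℝ (Δ f) (r • e) e) I := by
  have hD : ∀ r ∈ I, HasDerivAt (fun s : ℝ => s ^ (d - 1) * fderiv ℝ (Δ f) (s • e) e)
      (r ^ (d - 1) * Δ (Δ f) (r • e)) r := fun r hr =>
    hasDerivAt_flux he (contDiffAt_laplacian (hC r hr) (by norm_num))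
      (hrad.imp_right fun h => ⟨h.1 r hr, laplacian_radial h.2⟩)
  refine strictAntiOn_of_deriv_neg hc
    (fun r hr => (hD r hr).continuousAt.continuousWithinAt) fun r hr => ?_
  rw [hI.interior_eq] at hr
  rw [(hD r hr).deriv]
  exact mul_neg_of_pos_of_neg (hpos r hr) (hneg r hr)

/-! ### Averages of translates of a smooth function -/

section Average

variable {d : ℕ} {F : Type} [NormedAddCommGroup F]

theorem integrable_translate {ρ : Measure (RSp d)} [IsFiniteMeasure ρ] {g : RSp d → F}
    (hg : Continuous g) (hcs : HasCompactSupport g) (x : RSp d) :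
    Integrable (fun y => g (x - y)) ρ := by
  obtain ⟨C, hC⟩ := hcs.exists_bound_of_continuous hg
  exact Integrable.of_bound (by fun_prop : Continuous fun y => g (x - y)).aestronglyMeasurable C
    (Filter.Eventually.of_forall fun y => hC _)

variable [NormedSpace ℝ F]

/-- Convolution with a finite measure `ρ`, which is not translation invariant, so that the convolution
calculus for Haar measures does not apply. -/
theorem hasFDerivAt_integral_translate {ρ : Measure (RSp d)} [IsFiniteMeasure ρ] {g : RSp d → F}
    (hg : ContDiff ℝ 1 g) (hcs : HasCompactSupport g) (x : RSp d) :
    HasFDerivAt (fun x => ∫ y, g (x - y) ∂ρ) (∫ y, fderiv ℝ g (x - y) ∂ρ) x := by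
  have hcont := hg.continuous
  have hcont' := hg.continuous_fderiv (by simp)
  obtain ⟨C, hC⟩ := (hcs.fderiv (𝕜 := ℝ)).exists_bound_of_continuous hcont'
  refine hasFDerivAt_integral_of_dominated_of_fderiv_le (F' := fun x y => fderiv ℝ g (x - y))
    (bound := fun _ => C) (s := univ) Filter.univ_mem
    (Filter.Eventually.of_forall fun x => (by fun_prop : Continuous fun y => g (x - y)).aestronglyMeasurable)
    (integrable_translate hcont hcs x)
    (by fun_prop : Continuous fun y => fderiv ℝ g (x - y)).aestronglyMeasurable
    (Filter.Eventually.of_forall fun y x _ => hC _) (integrable_const C)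
    (Filter.Eventually.of_forall fun y x _ => ?_)
  have h1 : HasFDerivAt g (fderiv ℝ g (x - y)) (x - y) :=
    (hg.differentiable (by simp) _).hasFDerivAt
  have h2 := h1.comp x ((hasFDerivAt_id x).sub_const y)
  rwa [ContinuousLinearMap.comp_id] at h2

theorem fderiv_integral_translate {ρ : Measure (RSp d)} [IsFiniteMeasure ρ] {g : RSp d → F}
    (hg : ContDiff ℝ 1 g) (hcs : HasCompactSupport g) :
    fderiv ℝ (fun x => ∫ y, g (x - y) ∂ρ) = fun x => ∫ y, fderiv ℝ g (x - y) ∂ρ :=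
  funext fun x => (hasFDerivAt_integral_translate hg hcs x).fderiv

theorem continuous_integral_translate {ρ : Measure (RSp d)} [IsFiniteMeasure ρ] {g : RSp d → F}
    (hg : Continuous g) (hcs : HasCompactSupport g) : Continuous fun x => ∫ y, g (x - y) ∂ρ := by
  obtain ⟨C, hC⟩ := hcs.exists_bound_of_continuous hg
  exact MeasureTheory.continuous_of_dominated (bound := fun _ => C)
    (fun x => (by fun_prop : Continuous fun y => g (x - y)).aestronglyMeasurable)
    (fun x => Filter.Eventually.of_forall fun y => hC _) (integrable_const C)
    (Filter.Eventually.of_forall fun y => by fun_prop)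

end Average

theorem contDiff_integral_translate {d : ℕ} {ρ : Measure (RSp d)} [IsFiniteMeasure ρ] (n : ℕ) :
    ∀ {F : Type} [NormedAddCommGroup F] [NormedSpace ℝ F] {g : RSp d → F},
      ContDiff ℝ n g → HasCompactSupport g → ContDiff ℝ n fun x => ∫ y, g (x - y) ∂ρ := by
  induction n with
  | zero =>
    intro F _ _ g hg hcs
    exact contDiff_zero.2 (continuous_integral_translate (contDiff_zero.1 hg) hcs)
  | succ n ih =>
    intro F _ _ g hg hcs
    have hg1 : ContDiff ℝ 1 g := hg.of_le (by exact_mod_cast Nat.le_add_left 1 n)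
    push_cast at hg ⊢
    rw [contDiff_succ_iff_hasFDerivAt]
    exact ⟨_, ih (hg.fderiv_right le_rfl) (hcs.fderiv (𝕜 := ℝ)),
      hasFDerivAt_integral_translate hg1 hcs⟩


theorem fderiv_fderiv_apply {d : ℕ} {f : RSp d → ℝ} {x : RSp d} (hf : ContDiffAt ℝ 2 f x)
    (v w : RSp d) : fderiv ℝ (fderiv ℝ f) x v w = fderiv ℝ (fun z => fderiv ℝ f z w) x v := by
  have h : DifferentiableAt ℝ (fderiv ℝ f) x :=
    (hf.fderiv_right (m := 1) (by norm_num)).differentiableAt (by simp)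
  have h1 := h.hasFDerivAt.clm_apply (hasFDerivAt_const w x)
  rw [h1.fderiv]
  simp

theorem fderiv_integral_translate_apply {d : ℕ} {ρ : Measure (RSp d)} [IsFiniteMeasure ρ]
    {g : RSp d → ℝ} (hg : ContDiff ℝ 1 g) (hcs : HasCompactSupport g) (x v : RSp d) :
    fderiv ℝ (fun x => ∫ y, g (x - y) ∂ρ) x v = ∫ y, fderiv ℝ g (x - y) v ∂ρ := by
  rw [fderiv_integral_translate hg hcs]
  exact ContinuousLinearMap.integral_apply
    (integrable_translate (hg.continuous_fderiv (by simp)) (hcs.fderiv (𝕜 := ℝ)) x) v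

theorem laplacian_integral_translate {d : ℕ} {ρ : Measure (RSp d)} [IsFiniteMeasure ρ]
    {g : RSp d → ℝ} (hg : ContDiff ℝ 2 g) (hcs : HasCompactSupport g) (x : RSp d) :
    Δ (fun x => ∫ y, g (x - y) ∂ρ) x = ∫ y, Δ g (x - y) ∂ρ := by
  have hg1 : ContDiff ℝ 1 g := hg.of_le (by norm_num)
  set b := EuclideanSpace.basisFun (Fin d) ℝ
  have hgv : ∀ v, ContDiff ℝ 1 (fun z => fderiv ℝ g z v) := fun v =>
    (hg.fderiv_right (m := 1) (by norm_num)).clm_apply contDiff_const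
  have hcsv : ∀ v, HasCompactSupport (fun z => fderiv ℝ g z v) := fun v =>
    hcs.fderiv_apply (𝕜 := ℝ) v
  have hcsv' : ∀ v, HasCompactSupport (fun z => fderiv ℝ (fun z => fderiv ℝ g z v) z v) := fun v =>
    (hcsv v).fderiv_apply (𝕜 := ℝ) v
  have hconv : ContDiff ℝ 2 (fun x => ∫ y, g (x - y) ∂ρ) :=
    contDiff_integral_translate 2 hg hcs
  rw [laplacian_eq_sum_fderiv _ b]
  have h1 : ∀ i, fderiv ℝ (fderiv ℝ fun x => ∫ y, g (x - y) ∂ρ) x (b i) (b i) =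
      ∫ y, fderiv ℝ (fun z => fderiv ℝ g z (b i)) (x - y) (b i) ∂ρ := fun i => by
    rw [fderiv_fderiv_apply hconv.contDiffAt,
      funext fun z => fderiv_integral_translate_apply hg1 hcs z (b i),
      fderiv_integral_translate_apply (hgv _) (hcsv _)]
  rw [Finset.sum_congr rfl fun i _ => h1 i, ← integral_finsetSum _ fun i _ =>
    integrable_translate (((hgv (b i)).continuous_fderiv (by simp)).clm_apply continuous_const)
      (hcsv' (b i)) x]
  refine integral_congr_ae (Filter.Eventually.of_forall fun y => ?_)
  simp only [laplacian_eq_sum_fderiv g b (x - y), fderiv_fderiv_apply hg.contDiffAt]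

theorem hasCompactSupport_laplacian {d : ℕ} {g : RSp d → ℝ}
    (hcs : HasCompactSupport g) : HasCompactSupport (Δ g) := by
  refine HasCompactSupport.intro hcs.isCompact fun x hx => ?_
  have h : g =ᶠ[𝓝 x] fun _ => 0 := notMem_tsupport_iff_eventuallyEq.1 hx
  rw [(laplacian_congr_nhds h).eq_of_nhds]
  simp

/-! ### Continuity of the potential and integrability of its gradient -/

/-- As a function with values in `[0, ∞]` the potential is continuous also at a singularity, by lower
semicontinuity. -/
theorem SatisfiesHs.continuous {d : ℕ} {W : RSp d → ℝ≥0∞} (h : SatisfiesHs W) : Continuous W := by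
  rcases h.cont with ⟨hc, -, h0⟩ | ⟨hc, -⟩
  · rw [continuous_iff_continuousAt]
    intro x
    rcases eq_or_ne x 0 with rfl | hx
    · rw [ContinuousAt, h0, ENNReal.tendsto_nhds_top_iff_nnreal]
      exact fun c => h.lsc 0 c (h0.symm ▸ ENNReal.coe_lt_top : (c : ℝ≥0∞) < W 0)
    · exact hc.continuousAt (isOpen_compl_singleton.mem_nhds hx)
  · exact hc

theorem SatisfiesHs.ne_top {d : ℕ} {W : RSp d → ℝ≥0∞} (h : SatisfiesHs W) {x : RSp d}
    (hx : x ≠ 0) : W x ≠ ∞ := by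
  rcases h.cont with ⟨-, hc, -⟩ | ⟨-, hc⟩
  exacts [hc x hx, hc x]

theorem realPotential_radial {d : ℕ} {W : RSp d → ℝ≥0∞} (hradial : ∀ x y, ‖x‖ = ‖y‖ → W x = W y)
    (x y : RSp d) (hxy : ‖x‖ = ‖y‖) : realPotential W x = realPotential W y := by
  simp only [realPotential, hradial x y hxy]

/-- The gradient of a radial function is controlled by the radial derivative. -/
theorem norm_gradient_le_of_radial {d : ℕ} {f : RSp d → ℝ} (hf : ∀ x y, ‖x‖ = ‖y‖ → f x = f y)
    {e x : RSp d} (he : ‖e‖ = 1) (hx : x ≠ 0) (hC : DifferentiableAt ℝ f (‖x‖ • e)) :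
    ‖gradient f x‖ ≤ ‖fderiv ℝ f (‖x‖ • e) e‖ := by
  have h1 : HasDerivAt (fun s : ℝ => f (s • e)) (fderiv ℝ f (‖x‖ • e) e) ‖x‖ := hasDerivAt_ray hC
  have h2 : HasFDerivAt (fun y : RSp d => ‖y‖) (fderiv ℝ (fun y : RSp d => ‖y‖) x) x :=
    ((contDiffAt_norm (n := 1) ℝ hx).differentiableAt (by simp)).hasFDerivAt
  have h3 := h1.comp_hasFDerivAt x h2
  have h4 : ((fun s : ℝ => f (s • e)) ∘ fun y : RSp d => ‖y‖) = f :=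
    funext fun y => hf _ _ (by simp [norm_smul, he])
  rw [h4] at h3
  rw [gradient, LinearIsometryEquiv.norm_map, h3.fderiv, norm_smul]
  exact mul_le_of_le_one_right (norm_nonneg _)
    (by simpa using norm_fderiv_le_of_lipschitz ℝ (x₀ := x) (lipschitzWith_one_norm (E := RSp d)))

theorem measurable_gradient {d : ℕ} (f : RSp d → ℝ) : Measurable (gradient f) :=
  (LinearIsometryEquiv.continuous _).measurable.comp (measurable_fderiv ℝ f)

theorem contDiffAt_realPotential {d : ℕ} {W : RSp d → ℝ≥0∞}
    (hC4 : ContDiffOn ℝ 4 (realPotential W) {0}ᶜ) {x : RSp d} (hx : x ≠ 0) :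
    ContDiffAt ℝ 4 (realPotential W) x :=
  hC4.contDiffAt (isOpen_compl_singleton.mem_nhds hx)

/-- The radial flux of the potential is bounded below near the origin. This is where the sign of the
bi-Laplacian enters the local integrability of the gradient. -/
theorem exists_potential_flux_lower_bound {d : ℕ} {W : RSp d → ℝ≥0∞}
    (hC4 : ContDiffOn ℝ 4 (realPotential W) {0}ᶜ)
    (hradial : ∀ x y, ‖x‖ = ‖y‖ → W x = W y)
    (hbilap : ∀ x, x ≠ 0 → Δ (Δ (realPotential W)) x < 0) {e : RSp d} (he : ‖e‖ = 1)
    {K : ℝ} (hK : 0 < K) :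
    ∃ C, ∀ r ∈ Ioc 0 K, -C ≤ r ^ (d - 1) * fderiv ℝ (realPotential W) (r • e) e := by
  have hne : ∀ r ∈ Ioi (0 : ℝ), r • e ≠ 0 := fun r hr =>
    smul_ne_zero (ne_of_gt hr) (by rintro rfl; simp at he)
  have hrad := realPotential_radial hradial
  have hC : ∀ r ∈ Ioi (0 : ℝ), ContDiffAt ℝ 4 (realPotential W) (r • e) := fun r hr =>
    contDiffAt_realPotential hC4 (hne r hr)
  refine exists_flux_lower_bound (u := fun r => Δ (realPotential W) (r • e))
    (u' := fun r => fderiv ℝ (Δ (realPotential W)) (r • e) e)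
    (fun r hr => hasDerivAt_flux he ((hC r hr).of_le (by norm_num)) (Or.inr ⟨hr, hrad⟩))
    (fun r hr => hasDerivAt_ray ((contDiffAt_laplacian (n := 2) (hC r hr)
      (by norm_num)).differentiableAt (by simp)))
    (strictAntiOn_flux_laplacian he isOpen_Ioi (convex_Ioi 0) hC (Or.inr ⟨fun r hr => hr, hrad⟩)
      (fun r hr => pow_pos hr _) fun r hr => hbilap _ (hne r hr)) hK

/-- The classical gradient of the potential is locally integrable, including at the origin. -/
theorem integrableOn_gradient_potential {d : ℕ} (hd : 1 ≤ d) {W : RSp d → ℝ≥0∞}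
    (hC4 : ContDiffOn ℝ 4 (realPotential W) {0}ᶜ)
    (hradial : ∀ x y, ‖x‖ = ‖y‖ → W x = W y)
    (hbilap : ∀ x, x ≠ 0 → Δ (Δ (realPotential W)) x < 0) {K : ℝ} (hK : 0 < K) :
    IntegrableOn (gradient (realPotential W)) (Metric.ball 0 K) := by
  have : Nonempty (Fin d) := ⟨⟨0, hd⟩⟩
  obtain ⟨e, he⟩ := exists_norm_eq (RSp d) (zero_le_one' ℝ)
  have hne : ∀ r ∈ Ioi (0 : ℝ), r • e ≠ 0 := fun r hr =>
    smul_ne_zero (ne_of_gt hr) (by rintro rfl; simp at he)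
  have hrad := realPotential_radial hradial
  have hC : ∀ r ∈ Ioi (0 : ℝ), ContDiffAt ℝ 4 (realPotential W) (r • e) := fun r hr =>
    contDiffAt_realPotential hC4 (hne r hr)
  obtain ⟨C, hCb⟩ := exists_potential_flux_lower_bound hC4 hradial hbilap he hK
  have h1 : IntegrableOn (fun r : ℝ => r ^ (d - 1) * fderiv ℝ (realPotential W) (r • e) e)
      (Ioc 0 K) := by
    refine integrableOn_flux (w := fun r => realPotential W (r • e))
      (u := fun r => Δ (realPotential W) (r • e)) (fun r _ => ENNReal.toReal_nonneg)
      (fun r hr => hasDerivAt_ray ((hC r hr).differentiableAt (by simp)))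
      (fun r hr => hasDerivAt_flux he ((hC r hr).of_le (by norm_num)) (Or.inr ⟨hr, hrad⟩)) hK hCb
  have h2 : IntegrableOn (fun x : RSp d => fderiv ℝ (realPotential W) (‖x‖ • e) e)
      (Metric.ball 0 K) := by
    rw [integrableOn_fun_norm_addHaar volume (f := fun r => fderiv ℝ (realPotential W) (r • e) e)]
    simpa using h1.mono_set Ioo_subset_Ioc_self
  refine Integrable.mono h2 (measurable_gradient _).aestronglyMeasurable ?_
  have h0 : ∀ᵐ x ∂(volume : Measure (RSp d)), x ≠ 0 := Measure.ae_ne volume 0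
  filter_upwards [ae_restrict_of_ae h0] with x hx
  exact norm_gradient_le_of_radial hrad he hx ((hC _ (norm_pos_iff.2 hx)).differentiableAt (by simp))

/-- In dimension one the lower bound on the flux is a lower bound on `W'`, so `W` is bounded near
the origin and cannot be infinite there. -/
theorem potential_ne_top_of_dim_one {W : RSp 1 → ℝ≥0∞} (hHs : SatisfiesHs W)
    (hC4 : ContDiffOn ℝ 4 (realPotential W) {0}ᶜ)
    (hradial : ∀ x y, ‖x‖ = ‖y‖ → W x = W y)
    (hbilap : ∀ x, x ≠ 0 → Δ (Δ (realPotential W)) x < 0) (x : RSp 1) : W x ≠ ∞ := by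
  rcases ne_or_eq x 0 with hx | rfl
  · exact hHs.ne_top hx
  intro h0
  obtain ⟨e, he⟩ := exists_norm_eq (RSp 1) (zero_le_one' ℝ)
  have hne : ∀ r ∈ Ioi (0 : ℝ), r • e ≠ 0 := fun r hr =>
    smul_ne_zero (ne_of_gt hr) (by rintro rfl; simp at he)
  obtain ⟨C, hC⟩ := exists_potential_flux_lower_bound hC4 hradial hbilap he one_pos
  have hD : ∀ r ∈ Ioi (0 : ℝ), HasDerivAt (fun s : ℝ => realPotential W (s • e))
      (fderiv ℝ (realPotential W) (r • e) e) r := fun r hr =>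
    hasDerivAt_ray ((contDiffAt_realPotential hC4 (hne r hr)).differentiableAt (by simp))
  have hbound : ∀ r ∈ Ioo (0 : ℝ) 1, W (r • e) ≤ ENNReal.ofReal (realPotential W e + |C|) := by
    intro r hr
    obtain ⟨ξ, hξ, hξ'⟩ := exists_hasDerivAt_eq_slope _ _ hr.2
      (fun x hx => (hD x (hr.1.trans_le hx.1)).continuousAt.continuousWithinAt)
      (fun x hx => hD x (hr.1.trans hx.1))
    rw [eq_div_iff (by linarith [hr.2] : 1 - r ≠ 0), one_smul] at hξ'
    have h1 := hC ξ ⟨hr.1.trans hξ.1, hξ.2.le⟩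
    simp only [Nat.sub_self, pow_zero, one_mul] at h1
    rw [← ENNReal.ofReal_toReal (hHs.ne_top (hne r hr.1))]
    refine ENNReal.ofReal_le_ofReal ?_
    change realPotential W (r • e) ≤ _
    nlinarith [le_abs_self C, abs_nonneg C, hr.1, hr.2]
  have ht : Filter.Tendsto (fun r : ℝ => W (r • e)) (𝓝[>] 0) (𝓝 ∞) := by
    have h1 : Filter.Tendsto (fun r : ℝ => W (r • e)) (𝓝 0) (𝓝 (W ((0 : ℝ) • e))) :=
      (hHs.continuous.comp (by fun_prop : Continuous fun r : ℝ => r • e)).tendsto 0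
    rw [zero_smul, h0] at h1
    exact h1.mono_left nhdsWithin_le_nhds
  have h2 : (∞ : ℝ≥0∞) ≤ ENNReal.ofReal (realPotential W e + |C|) :=
    le_of_tendsto ht (Filter.eventually_of_mem (Ioo_mem_nhdsGT one_pos) hbound)
  exact absurd h2 (not_le.2 ENNReal.ofReal_lt_top)

/-! ### The convolution and its ball averages -/

/-- The average of `f` over the ball `B(x; r)`, in `[0, ∞]`. -/
def ballAvg {d : ℕ} (f : RSp d → ℝ≥0∞) (x : RSp d) (r : ℝ) : ℝ≥0∞ :=
  (volume (Metric.ball x r))⁻¹ * ∫⁻ y in Metric.ball x r, f y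

/-- The potential `W * ρ` generated by `ρ`, with values in `[0, ∞]`. -/
def pot {d : ℕ} (W : RSp d → ℝ≥0∞) (ρ : Measure (RSp d)) (x : RSp d) : ℝ≥0∞ :=
  ∫⁻ y, W (x - y) ∂ρ

theorem measurable_pot {d : ℕ} {W : RSp d → ℝ≥0∞} (hW : Measurable W) (ρ : Measure (RSp d))
    [SFinite ρ] : Measurable (pot W ρ) :=
  (hW.comp (measurable_fst.sub measurable_snd)).lintegral_prod_right'

theorem setLIntegral_ball_sub {d : ℕ} {f : RSp d → ℝ≥0∞} (hf : Measurable f) (x y : RSp d) (r : ℝ) :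
    ∫⁻ z in Metric.ball x r, f (z - y) = ∫⁻ z in Metric.ball (x - y) r, f z := by
  rw [← (measurePreserving_sub_right volume y).setLIntegral_comp_preimage measurableSet_ball hf]
  congr 2
  ext z
  simp [dist_eq_norm, sub_sub_sub_cancel_right]

theorem ballAvg_comp_sub {d : ℕ} {f : RSp d → ℝ≥0∞} (hf : Measurable f) (x y : RSp d) (r : ℝ) :
    ballAvg (fun z => f (z - y)) x r = ballAvg f (x - y) r := by
  simp only [ballAvg]
  rw [setLIntegral_ball_sub hf, Measure.addHaar_ball_center volume x,
    Measure.addHaar_ball_center volume (x - y)]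

theorem ballAvg_add {d : ℕ} {f g : RSp d → ℝ≥0∞} (hf : Measurable f) (x : RSp d) (r : ℝ) :
    ballAvg (fun z => f z + g z) x r = ballAvg f x r + ballAvg g x r := by
  simp only [ballAvg]
  rw [lintegral_add_left hf, mul_add]

theorem ballAvg_congr_ae {d : ℕ} {f g : RSp d → ℝ≥0∞} (h : ∀ᵐ z ∂(volume : Measure (RSp d)), f z = g z)
    (x : RSp d) (r : ℝ) : ballAvg f x r = ballAvg g x r := by
  simp only [ballAvg]
  rw [lintegral_congr_ae (ae_restrict_of_ae h)]

theorem measurable_ballAvg_sub {d : ℕ} {W : RSp d → ℝ≥0∞} (hW : Measurable W) (x : RSp d) (r : ℝ) :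
    Measurable fun y => ballAvg W (x - y) r := by
  simp_rw [← ballAvg_comp_sub hW, ballAvg]
  exact ((hW.comp (measurable_snd.sub measurable_fst)).lintegral_prod_right').const_mul _

theorem ballAvg_pot {d : ℕ} {W : RSp d → ℝ≥0∞} (hW : Measurable W) (ρ : Measure (RSp d))
    [SFinite ρ] (x : RSp d) (r : ℝ) :
    ballAvg (pot W ρ) x r = ∫⁻ y, ballAvg W (x - y) r ∂ρ := by
  simp_rw [← ballAvg_comp_sub hW]
  simp only [ballAvg, pot]
  rw [lintegral_const_mul, lintegral_lintegral_swap]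
  · exact (hW.comp (measurable_fst.sub measurable_snd)).aemeasurable
  · exact (hW.comp (measurable_snd.sub measurable_fst)).lintegral_prod_right'

theorem tendsto_ballAvg {d : ℕ} {f : RSp d → ℝ≥0∞} {x : RSp d} (hf : ContinuousAt f x) :
    Tendsto (ballAvg f x) (𝓝[>] 0) (𝓝 (f x)) := by
  have hball : ∀ {s : Set (RSp d)}, s ∈ 𝓝 x → ∀ᶠ r in 𝓝[>] (0 : ℝ), 0 < r ∧ Metric.ball x r ⊆ s := by
    intro s hs
    obtain ⟨ε, hε, hs⟩ := Metric.mem_nhds_iff.1 hs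
    filter_upwards [Ioo_mem_nhdsGT hε] with r hr
    exact ⟨hr.1, (Metric.ball_subset_ball hr.2.le).trans hs⟩
  have h0 : ∀ r : ℝ, 0 < r → volume (Metric.ball x r) ≠ 0 := fun r hr =>
    (Metric.measure_ball_pos volume x hr).ne'
  have htop : ∀ r : ℝ, volume (Metric.ball x r) ≠ ∞ := fun r => measure_ball_lt_top.ne
  refine tendsto_order.2 ⟨fun a ha => ?_, fun a ha => ?_⟩
  · obtain ⟨c, hac, hc⟩ := exists_between ha
    filter_upwards [hball (hf.eventually (lt_mem_nhds hc))] with r ⟨hr, hsub⟩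
    refine hac.trans_le ?_
    rw [ballAvg, mul_comm, ← div_eq_mul_inv,
      ENNReal.le_div_iff_mul_le (Or.inl (h0 r hr)) (Or.inl (htop r)), ← setLIntegral_const]
    exact setLIntegral_mono' measurableSet_ball fun y hy => (hsub hy).le
  · obtain ⟨c, hc, hac⟩ := exists_between ha
    filter_upwards [hball (hf.eventually (gt_mem_nhds hc))] with r ⟨hr, hsub⟩
    refine lt_of_le_of_lt ?_ hac
    rw [ballAvg, ENNReal.inv_mul_le_iff (h0 r hr) (htop r), mul_comm, ← setLIntegral_const]
    exact setLIntegral_mono' measurableSet_ball fun y hy => (hsub hy).le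

/-- The ball averages of the potential of a compactly supported measure converge to the potential at
every point: by dominated convergence where the potential is finite, the domination being the
average condition in (H-s), and by Fatou's lemma where it is infinite. -/
theorem tendsto_ballAvg_pot {d : ℕ} {W : RSp d → ℝ≥0∞} (hHs : SatisfiesHs W)
    {ρ : Measure (RSp d)} [IsFiniteMeasure ρ] {M : ℝ} (hM : ∀ᵐ y ∂ρ, ‖y‖ ≤ M) (x : RSp d)
    {r : ℕ → ℝ} (hr : Tendsto r atTop (𝓝[>] 0)) (hr0 : ∀ n, 0 < r n) (hr1 : ∀ n, r n ≤ 1) :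
    Tendsto (fun n => ballAvg (pot W ρ) x (r n)) atTop (𝓝 (pot W ρ x)) := by
  have hW : Measurable W := hHs.continuous.measurable
  have hpt : ∀ y, Tendsto (fun n => ballAvg W (x - y) (r n)) atTop (𝓝 (W (x - y))) := fun y =>
    (tendsto_ballAvg hHs.continuous.continuousAt).comp hr
  simp_rw [ballAvg_pot hW]
  by_cases htop : pot W ρ x = ∞
  · have h1 := lintegral_liminf_le (μ := ρ) (u := atTop) (f := fun n y => ballAvg W (x - y) (r n))
      fun n => measurable_ballAvg_sub hW x (r n)
    simp_rw [(hpt _).liminf_eq] at h1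
    change pot W ρ x ≤ _ at h1
    rw [htop, top_le_iff] at h1
    rw [htop]
    exact tendsto_of_le_liminf_of_limsup_le h1.ge le_top
  · set R := max (‖x‖ + M) 1 with hR
    obtain ⟨C, -, hC⟩ := hHs.average_le R (lt_max_of_lt_right one_pos)
    refine tendsto_lintegral_of_dominated_convergence (fun y => ENNReal.ofReal C * W (x - y))
      (fun n => measurable_ballAvg_sub hW x (r n)) (fun n => ?_) ?_ (ae_of_all _ hpt)
    · filter_upwards [hM] with y hy
      refine hC (x - y) ?_ (r n) (hr0 n) ((hr1 n).trans (le_max_right _ _))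
      exact ((norm_sub_le x y).trans (by linarith)).trans (le_max_left _ _)
    · have hm : Measurable fun y => W (x - y) := hW.comp (by fun_prop)
      rw [lintegral_const_mul _ hm]
      exact ENNReal.mul_ne_top ENNReal.ofReal_ne_top htop

theorem exists_radii : ∃ r : ℕ → ℝ, Tendsto r atTop (𝓝[>] 0) ∧ (∀ n, 0 < r n) ∧ ∀ n, r n ≤ 1 := by
  refine ⟨fun n => 1 / ((n : ℝ) + 1), tendsto_nhdsWithin_iff.2
    ⟨tendsto_one_div_add_atTop_nhds_zero_nat, Eventually.of_forall fun n => ?_⟩, fun n => ?_,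
    fun n => ?_⟩
  · exact mem_Ioi.2 (by positivity)
  · positivity
  · rw [div_le_one (by positivity)]
    linarith [Nat.cast_nonneg (α := ℝ) n]

/-- The convolution of a locally integrable function with a compactly supported measure is finite
almost everywhere. -/
theorem ae_lintegral_sub_lt_top {d : ℕ} {F : RSp d → ℝ≥0∞} (hF : Measurable F)
    (hloc : ∀ K : ℝ, 0 < K → ∫⁻ z in Metric.ball 0 K, F z < ∞) {κ : Measure (RSp d)}
    [IsFiniteMeasure κ] {M : ℝ} (hM : ∀ᵐ y ∂κ, ‖y‖ ≤ M) :
    ∀ᵐ z ∂(volume : Measure (RSp d)), ∫⁻ y, F (z - y) ∂κ < ∞ := by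
  have hmeas : Measurable fun z => ∫⁻ y, F (z - y) ∂κ :=
    (hF.comp (measurable_fst.sub measurable_snd)).lintegral_prod_right'
  have hK : ∀ n : ℕ, ∀ᵐ z ∂(volume : Measure (RSp d)), z ∈ Metric.ball (0 : RSp d) n →
      ∫⁻ y, F (z - y) ∂κ < ∞ := by
    intro n
    rw [← ae_restrict_iff' measurableSet_ball]
    refine ae_lt_top hmeas (ne_of_lt ?_)
    rw [lintegral_lintegral_swap (f := fun z y => F (z - y))
      (hF.comp (measurable_fst.sub measurable_snd)).aemeasurable]
    simp_rw [setLIntegral_ball_sub hF]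
    set L := max (n + M) 1 with hL
    calc ∫⁻ y, (∫⁻ z in Metric.ball (0 - y) n, F z) ∂κ
        ≤ ∫⁻ _, (∫⁻ z in Metric.ball 0 L, F z) ∂κ := by
          refine lintegral_mono_ae ?_
          filter_upwards [hM] with y hy
          refine lintegral_mono_set (Metric.ball_subset_ball' ?_)
          rw [dist_zero_right, zero_sub, norm_neg]
          exact (by linarith : (n : ℝ) + ‖y‖ ≤ n + M).trans (le_max_left _ _)
      _ < ∞ := by
          rw [lintegral_const]
          exact ENNReal.mul_lt_top (hloc L (lt_max_of_lt_right one_pos)) (measure_lt_top _ _)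
  rw [← ae_all_iff] at hK
  filter_upwards [hK] with z hz
  obtain ⟨n, hn⟩ := exists_nat_gt ‖z‖
  exact hz n (by simpa using hn)

theorem SatisfiesHs.lintegral_ball_lt_top {d : ℕ} {W : RSp d → ℝ≥0∞} (hHs : SatisfiesHs W) (K : ℝ) :
    ∫⁻ z in Metric.ball 0 K, W z < ∞ :=
  (lintegral_mono_set Metric.ball_subset_closedBall).trans_lt
    (hHs.locInt _ (isCompact_closedBall 0 K))

/-! ### Continuous differentiability of the convolution -/

/-- The fundamental theorem of calculus for the potential along a segment, which may pass through the
origin if the potential is finite there. -/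
theorem integral_gradient_segment {d : ℕ} {W : RSp d → ℝ≥0∞} (hHs : SatisfiesHs W)
    (hC4 : ContDiffOn ℝ 4 (realPotential W) {0}ᶜ) {p h : RSp d} (hh : h ≠ 0)
    (hp : (∀ x, W x ≠ ∞) ∨ ∀ s : ℝ, p + s • h ≠ 0)
    (hint : IntervalIntegrable (fun s : ℝ => inner ℝ (gradient (realPotential W) (p + s • h)) h)
      volume 0 1) :
    ∫ s in (0 : ℝ)..1, inner ℝ (gradient (realPotential W) (p + s • h)) h =
      realPotential W (p + h) - realPotential W p := by
  have hcount : {s : ℝ | p + s • h = 0}.Countable := by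
    refine Set.Subsingleton.countable fun s hs t ht => ?_
    have : s • h = t • h := add_left_cancel (hs.trans ht.symm)
    exact smul_left_injective ℝ hh this
  have hcont : Continuous fun s : ℝ => realPotential W (p + s • h) := by
    have hc : Continuous fun s : ℝ => W (p + s • h) := hHs.continuous.comp (by fun_prop)
    rw [continuous_iff_continuousAt]
    intro s
    refine (ENNReal.tendsto_toReal ?_).comp hc.continuousAt
    exact hp.elim (fun h => h _) fun h => hHs.ne_top (h s)
  have h1 := integral_eq_of_hasDerivAt_off_countable (fun s : ℝ => realPotential W (p + s • h))
    (fun s => inner ℝ (gradient (realPotential W) (p + s • h)) h) (a := 0) (b := 1) hcount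
    hcont.continuousOn (fun s hs => ?_) hint
  · simpa using h1
  · have hd : DifferentiableAt ℝ (realPotential W) (p + s • h) :=
      (contDiffAt_realPotential hC4 hs.2).differentiableAt (by simp)
    have hray : HasDerivAt (fun s : ℝ => p + s • h) h s := by
      simpa using ((hasDerivAt_id s).smul_const h).const_add p
    exact hd.hasGradientAt.hasFDerivAt.comp_hasDerivAt s hray

/-- For almost every `z`, the segments `z - y + [0, 1] h` avoid the origin for `ρ`-almost every `y`,
unless the dimension is one. -/
theorem ae_segment_ne_zero {d : ℕ} (hd : 2 ≤ d) (ρ : Measure (RSp d)) [SFinite ρ] (h : RSp d) :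
    ∀ᵐ z ∂(volume : Measure (RSp d)), ∀ᵐ y ∂ρ, ∀ s : ℝ, z - y + s • h ≠ 0 := by
  set L : Submodule ℝ (RSp d) := Submodule.span ℝ {h} with hL
  have hLtop : L ≠ ⊤ := by
    intro htop
    have h1 : Module.finrank ℝ L ≤ 1 := by
      simpa using finrank_span_le_card (R := ℝ) ({h} : Set (RSp d))
    rw [htop, finrank_top, finrank_euclideanSpace_fin] at h1
    omega
  have hLc : IsClosed (L : Set (RSp d)) := L.closed_of_finiteDimensional
  have hmem : ∀ᵐ z ∂(volume : Measure (RSp d)), ∀ᵐ y ∂ρ, z - y ∉ L := by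
    rw [Measure.ae_ae_comm]
    · refine ae_of_all _ fun y => ?_
      have h0 : ∀ᵐ z ∂(volume : Measure (RSp d)), z ∉ L :=
        measure_eq_zero_iff_ae_notMem.1 (Measure.addHaar_submodule volume L hLtop)
      exact (measurePreserving_sub_right volume y).quasiMeasurePreserving.ae h0
    · exact (hLc.isOpen_compl.preimage (continuous_fst.sub continuous_snd)).measurableSet
  filter_upwards [hmem] with z hz
  filter_upwards [hz] with y hy s hs
  refine hy ?_
  rw [eq_neg_of_add_eq_zero_left hs]
  exact L.neg_mem (L.smul_mem s (Submodule.mem_span_singleton_self h))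

/-- Differences of the potential at almost every pair of points `z`, `z + h` are given by the line
integral of the continuous representative of `∇W * ρ`. -/
theorem ae_pot_sub_eq {d : ℕ} (hd : 1 ≤ d) {W : RSp d → ℝ≥0∞} (hHs : SatisfiesHs W)
    (hC4 : ContDiffOn ℝ 4 (realPotential W) {0}ᶜ)
    (hradial : ∀ x y, ‖x‖ = ‖y‖ → W x = W y)
    (hbilap : ∀ x, x ≠ 0 → Laplacian.laplacian (Laplacian.laplacian (realPotential W)) x < 0)
    {ρ : Measure (RSp d)} [IsProbabilityMeasure ρ] {M : ℝ} (hM : ∀ᵐ y ∂ρ, ‖y‖ ≤ M)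
    {G : RSp d → RSp d}
    (hG : ∀ᵐ x ∂(volume : Measure (RSp d)),
      Integrable (fun y => gradient (realPotential W) (x - y)) ρ ∧
        ∫ y, gradient (realPotential W) (x - y) ∂ρ = G x) (h : RSp d) :
    ∀ᵐ z ∂(volume : Measure (RSp d)), pot W ρ z < ∞ ∧ pot W ρ (z + h) < ∞ ∧
      (pot W ρ (z + h)).toReal - (pot W ρ z).toReal =
        ∫ s in (0 : ℝ)..1, inner ℝ (G (z + s • h)) h := by
  have hWm : Measurable W := hHs.continuous.measurable
  have hgm : Measurable (gradient (realPotential W)) := measurable_gradient _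
  have htrans : ∀ (v : RSp d) {p : RSp d → Prop}, (∀ᵐ z ∂(volume : Measure (RSp d)), p z) →
      ∀ᵐ z ∂(volume : Measure (RSp d)), p (z + v) := fun v p hp =>
    (measurePreserving_add_right volume v).quasiMeasurePreserving.ae hp
  have hfin : ∀ᵐ z ∂(volume : Measure (RSp d)), pot W ρ z < ∞ :=
    ae_lintegral_sub_lt_top hWm (fun K _ => hHs.lintegral_ball_lt_top K) hM
  have hfin' := htrans h hfin
  rcases eq_or_ne h 0 with rfl | hh
  · filter_upwards [hfin] with z hz
    simp [hz]
  set κ : Measure (RSp d × ℝ) := ρ.prod (volume.restrict (Ioc 0 1)) with hκ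
  have hT : Measurable fun p : RSp d × ℝ => p.1 - p.2 • h := by fun_prop
  -- Absolute integrability along the segments, from the local integrability of the gradient.
  have hA : ∀ᵐ z ∂(volume : Measure (RSp d)),
      ∫⁻ p, ‖gradient (realPotential W) (z - (p.1 - p.2 • h))‖ₑ ∂κ < ∞ := by
    have hbound : ∀ᵐ y ∂(κ.map fun p : RSp d × ℝ => p.1 - p.2 • h), ‖y‖ ≤ M + ‖h‖ := by
      rw [ae_map_iff hT.aemeasurable (isClosed_le continuous_norm continuous_const).measurableSet]
      have h1 : ∀ᵐ p ∂κ, ‖p.1‖ ≤ M := Measure.quasiMeasurePreserving_fst.ae hM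
      have h2 : ∀ᵐ p ∂κ, p.2 ∈ Ioc (0 : ℝ) 1 :=
        Measure.quasiMeasurePreserving_snd.ae (ae_restrict_mem measurableSet_Ioc)
      filter_upwards [h1, h2] with p hp1 hp2
      refine (norm_sub_le _ _).trans (add_le_add hp1 ?_)
      rw [norm_smul, Real.norm_of_nonneg hp2.1.le]
      exact mul_le_of_le_one_left (norm_nonneg _) hp2.2
    have h1 := ae_lintegral_sub_lt_top (F := fun z => ‖gradient (realPotential W) z‖ₑ) hgm.enorm
      (fun K hK => (integrableOn_gradient_potential hd hC4 hradial hbilap hK).2) hbound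
    filter_upwards [h1] with z hz
    rwa [lintegral_map (by fun_prop) hT] at hz
  -- Almost every segment is admissible for the fundamental theorem of calculus.
  have hB : ∀ᵐ z ∂(volume : Measure (RSp d)), ∀ᵐ y ∂ρ,
      (∀ x, W x ≠ ∞) ∨ ∀ s : ℝ, z - y + s • h ≠ 0 := by
    rcases hd.eq_or_lt with rfl | hd2
    · exact ae_of_all _ fun z => ae_of_all _ fun y =>
        Or.inl (potential_ne_top_of_dim_one hHs hC4 hradial hbilap)
    · filter_upwards [ae_segment_ne_zero hd2 ρ h] with z hz
      exact hz.mono fun y hy => Or.inr hy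
  -- The defining identity of `G` holds almost everywhere on almost every segment.
  have hCz : ∀ᵐ z ∂(volume : Measure (RSp d)), ∀ᵐ s ∂(volume.restrict (Ioc (0 : ℝ) 1)),
      ∫ y, gradient (realPotential W) (z + s • h - y) ∂ρ = G (z + s • h) ∧
        Integrable (fun y => gradient (realPotential W) (z + s • h - y)) ρ := by
    obtain ⟨N, hN, hNm, hN0⟩ := exists_measurable_superset_of_null (ae_iff.1 hG)
    have h1 : ∀ᵐ z ∂(volume : Measure (RSp d)), ∀ᵐ s ∂(volume.restrict (Ioc (0 : ℝ) 1)),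
        z + s • h ∉ N := by
      rw [Measure.ae_ae_comm]
      · exact ae_of_all _ fun s => htrans (s • h) (measure_eq_zero_iff_ae_notMem.1 hN0)
      · exact hNm.compl.preimage (by fun_prop : Measurable fun p : RSp d × ℝ => p.1 + p.2 • h)
    filter_upwards [h1] with z hz
    filter_upwards [hz] with s hs
    have := not_not.1 fun hns => hs (hN hns)
    exact ⟨this.2, this.1⟩
  filter_upwards [hfin, hfin', hA, hB, hCz] with z hz hz' hAz hBz hCz
  refine ⟨hz, hz', ?_⟩
  have hpot : ∀ x, pot W ρ x < ∞ → (Integrable (fun y => realPotential W (x - y)) ρ ∧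
      ∫ y, realPotential W (x - y) ∂ρ = (pot W ρ x).toReal) := by
    intro x hx
    have hm : Measurable fun y => W (x - y) := hWm.comp (by fun_prop)
    exact ⟨integrable_toReal_of_lintegral_ne_top hm.aemeasurable hx.ne,
      integral_toReal hm.aemeasurable (ae_lt_top hm hx.ne)⟩
  set F : RSp d → ℝ → ℝ := fun y s => inner ℝ (gradient (realPotential W) (z - y + s • h)) h with hF
  have hFint : Integrable (Function.uncurry F) κ := by
    have hg : Integrable (fun p : RSp d × ℝ => gradient (realPotential W) (z - p.1 + p.2 • h)) κ := by
      refine ⟨(hgm.comp (by fun_prop)).aestronglyMeasurable, ?_⟩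
      rw [HasFiniteIntegral]
      simpa only [sub_sub_eq_add_sub, add_sub_right_comm] using hAz
    exact hg.inner_const h
  have hswap : ∫ y, (∫ s in Ioc (0 : ℝ) 1, F y s) ∂ρ = ∫ s in Ioc (0 : ℝ) 1, (∫ y, F y s ∂ρ) :=
    integral_integral_swap hFint
  rw [← (hpot _ hz).2, ← (hpot _ hz').2, ← integral_sub (hpot _ hz').1 (hpot _ hz).1]
  calc ∫ y, (realPotential W (z + h - y) - realPotential W (z - y)) ∂ρ
      = ∫ y, (∫ s in Ioc (0 : ℝ) 1, F y s) ∂ρ := by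
        refine integral_congr_ae ?_
        filter_upwards [hBz, hFint.prod_right_ae] with y hy hyi
        have h1 := integral_gradient_segment hHs hC4 (p := z - y) hh hy
          ((intervalIntegrable_iff_integrableOn_Ioc_of_le zero_le_one).2 hyi)
        rw [intervalIntegral.integral_of_le zero_le_one] at h1
        rw [h1, add_sub_right_comm]
    _ = ∫ s in Ioc (0 : ℝ) 1, (∫ y, F y s ∂ρ) := hswap
    _ = ∫ s in Ioc (0 : ℝ) 1, inner ℝ (G (z + s • h)) h := by
        refine integral_congr_ae ?_
        filter_upwards [hCz] with s hs
        have h1 : ∀ y, F y s = inner ℝ (gradient (realPotential W) (z + s • h - y)) h := fun y => by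
          simp only [hF, add_sub_right_comm]
        simp_rw [h1, ← hs.1, real_inner_comm h]
        exact integral_inner hs.2 h
    _ = _ := (intervalIntegral.integral_of_le zero_le_one).symm

/-- Differences of the potential of `ρ` are line integrals of `G` everywhere; passing from almost
everywhere to everywhere uses the convergence of the ball averages. -/
theorem pot_sub_eq {d : ℕ} (hd : 1 ≤ d) {W : RSp d → ℝ≥0∞} (hHs : SatisfiesHs W)
    (hC4 : ContDiffOn ℝ 4 (realPotential W) {0}ᶜ)
    (hradial : ∀ x y, ‖x‖ = ‖y‖ → W x = W y)
    (hbilap : ∀ x, x ≠ 0 → Laplacian.laplacian (Laplacian.laplacian (realPotential W)) x < 0)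
    {ρ : Measure (RSp d)} [IsProbabilityMeasure ρ] {M : ℝ} (hM : ∀ᵐ y ∂ρ, ‖y‖ ≤ M)
    {G : RSp d → RSp d} (hGc : Continuous G)
    (hG : ∀ᵐ x ∂(volume : Measure (RSp d)),
      Integrable (fun y => gradient (realPotential W) (x - y)) ρ ∧
        ∫ y, gradient (realPotential W) (x - y) ∂ρ = G x) :
    (∀ x, pot W ρ x < ∞) ∧ ∀ x h, (pot W ρ (x + h)).toReal - (pot W ρ x).toReal =
        ∫ s in (0 : ℝ)..1, inner ℝ (G (x + s • h)) h := by
  have hWm : Measurable W := hHs.continuous.measurable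
  have hpm : Measurable (pot W ρ) := measurable_pot hWm ρ
  have hΦc : ∀ h, Continuous fun z => ∫ s in (0 : ℝ)..1, inner ℝ (G (z + s • h)) h := fun h =>
    intervalIntegral.continuous_parametric_intervalIntegral_of_continuous'
      (f := fun z s => inner ℝ (G (z + s • h)) h) (by unfold Function.uncurry; fun_prop) 0 1
  -- Splitting the line integral into its positive and negative parts allows infinite potentials.
  have key : ∀ x h, pot W ρ (x + h) +
      ENNReal.ofReal (-∫ s in (0 : ℝ)..1, inner ℝ (G (x + s • h)) h) =
      pot W ρ x + ENNReal.ofReal (∫ s in (0 : ℝ)..1, inner ℝ (G (x + s • h)) h) := by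
    intro x h
    set Φ : RSp d → ℝ := fun z => ∫ s in (0 : ℝ)..1, inner ℝ (G (z + s • h)) h with hΦ
    -- The shift is written as `z - -h` to match the translation lemma for ball averages.
    have hae : ∀ᵐ z ∂(volume : Measure (RSp d)),
        pot W ρ (z - -h) + ENNReal.ofReal (-Φ z) = pot W ρ z + ENNReal.ofReal (Φ z) := by
      filter_upwards [ae_pot_sub_eq hd hHs hC4 hradial hbilap hM hG h] with z ⟨h1, h2, h3⟩
      rw [sub_neg_eq_add, ← ENNReal.ofReal_toReal h1.ne, ← ENNReal.ofReal_toReal h2.ne]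
      have h3 : (pot W ρ (z + h)).toReal - (pot W ρ z).toReal = Φ z := h3
      rcases le_total 0 (Φ z) with h0 | h0
      · rw [ENNReal.ofReal_of_nonpos (neg_nonpos.2 h0), add_zero,
          ← ENNReal.ofReal_add ENNReal.toReal_nonneg h0, ← h3]
        congr 1; ring
      · rw [ENNReal.ofReal_of_nonpos h0, add_zero,
          ← ENNReal.ofReal_add ENNReal.toReal_nonneg (neg_nonneg.2 h0), ← h3]
        congr 1; ring
    obtain ⟨r, hr, hr0, hr1⟩ := exists_radii
    have hcΦ : Continuous fun z => ENNReal.ofReal (Φ z) := ENNReal.continuous_ofReal.comp (hΦc h)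
    have hcΦ' : Continuous fun z => ENNReal.ofReal (-Φ z) :=
      ENNReal.continuous_ofReal.comp (hΦc h).neg
    have hm' : Measurable fun z => pot W ρ (z - -h) := hpm.comp (by fun_prop)
    have heq : ∀ n, ballAvg (pot W ρ) (x - -h) (r n) +
        ballAvg (fun z => ENNReal.ofReal (-Φ z)) x (r n) =
        ballAvg (pot W ρ) x (r n) + ballAvg (fun z => ENNReal.ofReal (Φ z)) x (r n) := fun n => by
      rw [← ballAvg_comp_sub hpm, ← ballAvg_add hm', ← ballAvg_add hpm, ballAvg_congr_ae hae]
    have hl := (tendsto_ballAvg_pot hHs hM (x - -h) hr hr0 hr1).add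
      ((tendsto_ballAvg (x := x) hcΦ'.continuousAt).comp hr)
    have hrr := (tendsto_ballAvg_pot hHs hM x hr hr0 hr1).add
      ((tendsto_ballAvg (x := x) hcΦ.continuousAt).comp hr)
    have := tendsto_nhds_unique (hl.congr heq) hrr
    rwa [sub_neg_eq_add] at this
  have hfin : ∀ x, pot W ρ x < ∞ := by
    have h0 : ∀ᵐ z ∂(volume : Measure (RSp d)), pot W ρ z < ∞ :=
      ae_lintegral_sub_lt_top hWm (fun K _ => hHs.lintegral_ball_lt_top K) hM
    obtain ⟨x₀, hx₀⟩ := h0.exists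
    intro x
    have h1 := key x₀ (x - x₀)
    rw [add_sub_cancel] at h1
    exact (le_self_add.trans h1.le).trans_lt (ENNReal.add_lt_top.2 ⟨hx₀, ENNReal.ofReal_lt_top⟩)
  refine ⟨hfin, fun x h => ?_⟩
  have h1 := congrArg ENNReal.toReal (key x h)
  rw [ENNReal.toReal_add (hfin _).ne ENNReal.ofReal_ne_top,
    ENNReal.toReal_add (hfin _).ne ENNReal.ofReal_ne_top, ENNReal.toReal_ofReal',
    ENNReal.toReal_ofReal'] at h1
  have h2 := max_zero_sub_max_neg_zero_eq_self (∫ s in (0 : ℝ)..1, inner ℝ (G (x + s • h)) h)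
  linarith

/-- A function whose differences are line integrals of a continuous vector field is differentiable
with that gradient. -/
theorem hasGradientAt_of_sub_eq_integral {d : ℕ} {V : RSp d → ℝ} {G : RSp d → RSp d}
    (hG : Continuous G)
    (hV : ∀ x h, V (x + h) - V x = ∫ s in (0 : ℝ)..1, inner ℝ (G (x + s • h)) h) (x : RSp d) :
    HasGradientAt V (G x) x := by
  rw [hasGradientAt_iff_isLittleO, Asymptotics.isLittleO_iff]
  intro c hc
  obtain ⟨δ, hδ, hball⟩ := Metric.continuousAt_iff.1 hG.continuousAt c hc
  filter_upwards [Metric.ball_mem_nhds x hδ] with y hy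
  have h1 := hV x (y - x)
  rw [add_sub_cancel] at h1
  have h2 : ∫ s in (0 : ℝ)..1, inner ℝ (G x) (y - x) = inner ℝ (G x) (y - x) := by simp
  have hi : ∀ f : ℝ → RSp d, Continuous f →
      IntervalIntegrable (fun s => inner ℝ (f s) (y - x)) volume 0 1 := fun f hf =>
    (hf.inner continuous_const).intervalIntegrable _ _
  rw [h1, ← h2, ← intervalIntegral.integral_sub (hi _ (by fun_prop)) (hi _ (by fun_prop))]
  refine (intervalIntegral.norm_integral_le_of_norm_le_const
    (C := c * ‖y - x‖) fun s hs => ?_).trans (by simp)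
  rw [uIoc_of_le zero_le_one] at hs
  rw [← inner_sub_left]
  refine (norm_inner_le_norm _ _).trans (mul_le_mul_of_nonneg_right ?_ (norm_nonneg _))
  rw [← dist_eq_norm]
  refine (hball ?_).le
  rw [dist_eq_norm, add_sub_cancel_left, norm_smul, Real.norm_of_nonneg hs.1.le]
  rw [Metric.mem_ball, dist_eq_norm] at hy
  exact (mul_le_of_le_one_left (norm_nonneg _) hs.2).trans_lt hy

/-! ### Mutual energy and linear interpolation -/

/-- The mutual energy `∫∫ W(x - y) dν(y) dμ(x)`; twice the interaction energy on the diagonal. -/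
def mutualEnergy {d : ℕ} (W : RSp d → ℝ≥0∞) (μ ν : Measure (RSp d)) : ℝ≥0∞ :=
  ∫⁻ x, pot W ν x ∂μ

theorem interactionEnergy_eq {d : ℕ} (W : RSp d → ℝ≥0∞) (ρ : Measure (RSp d)) :
    interactionEnergy W ρ = 2⁻¹ * mutualEnergy W ρ ρ := rfl

theorem mutualEnergy_self {d : ℕ} (W : RSp d → ℝ≥0∞) (ρ : Measure (RSp d)) :
    mutualEnergy W ρ ρ = 2 * interactionEnergy W ρ := by
  rw [interactionEnergy_eq, ← mul_assoc, ENNReal.mul_inv_cancel two_ne_zero ENNReal.ofNat_ne_top,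
    one_mul]

theorem mutualEnergy_comm {d : ℕ} {W : RSp d → ℝ≥0∞} (hW : Measurable W)
    (hsymm : ∀ x, W (-x) = W x) (μ ν : Measure (RSp d)) [SFinite μ] [SFinite ν] :
    mutualEnergy W μ ν = mutualEnergy W ν μ := by
  simp only [mutualEnergy, pot]
  rw [lintegral_lintegral_swap (f := fun x y => W (x - y))
    (hW.comp (measurable_fst.sub measurable_snd)).aemeasurable]
  simp_rw [fun x y : RSp d => (by rw [← hsymm, neg_sub] : W (y - x) = W (x - y))]

theorem pot_add_smul {d : ℕ} (W : RSp d → ℝ≥0∞) (a b : ℝ≥0∞) (μ ν : Measure (RSp d)) (x : RSp d) :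
    pot W (a • μ + b • ν) x = a * pot W μ x + b * pot W ν x := by
  simp only [pot, lintegral_add_measure, lintegral_smul_measure, smul_eq_mul]

theorem mutualEnergy_linInterp {d : ℕ} {W : RSp d → ℝ≥0∞} (hW : Measurable W)
    (hsymm : ∀ x, W (-x) = W x) (ρ σ : Measure (RSp d)) [SFinite ρ] [SFinite σ] (t : ℝ) :
    mutualEnergy W (linInterp ρ σ t) (linInterp ρ σ t) =
      ENNReal.ofReal (1 - t) * (ENNReal.ofReal (1 - t) * mutualEnergy W ρ ρ +
        ENNReal.ofReal t * mutualEnergy W ρ σ) +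
      ENNReal.ofReal t * (ENNReal.ofReal (1 - t) * mutualEnergy W ρ σ +
        ENNReal.ofReal t * mutualEnergy W σ σ) := by
  nth_rw 2 [mutualEnergy_comm hW hsymm ρ σ]
  have h1 : ∀ x, pot W (linInterp ρ σ t) x =
      ENNReal.ofReal (1 - t) * pot W ρ x + ENNReal.ofReal t * pot W σ x := pot_add_smul W _ _ ρ σ
  have hρ := measurable_pot hW ρ
  have hσ := measurable_pot hW σ
  have h2 : ∀ μ : Measure (RSp d), ∫⁻ x, pot W (linInterp ρ σ t) x ∂μ =
      ENNReal.ofReal (1 - t) * mutualEnergy W μ ρ + ENNReal.ofReal t * mutualEnergy W μ σ := by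
    intro μ
    simp_rw [h1]
    rw [lintegral_add_left (hρ.const_mul _), lintegral_const_mul _ hρ, lintegral_const_mul _ hσ]
    rfl
  calc mutualEnergy W (linInterp ρ σ t) (linInterp ρ σ t)
      = ENNReal.ofReal (1 - t) * (∫⁻ x, pot W (linInterp ρ σ t) x ∂ρ) +
        ENNReal.ofReal t * ∫⁻ x, pot W (linInterp ρ σ t) x ∂σ := by
        conv_lhs => rw [mutualEnergy]
        conv_lhs => rw [show ∫⁻ x, pot W (linInterp ρ σ t) x ∂(linInterp ρ σ t) =
          ∫⁻ x, pot W (linInterp ρ σ t) x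
            ∂(ENNReal.ofReal (1 - t) • ρ + ENNReal.ofReal t • σ) from rfl]
        rw [lintegral_add_measure, lintegral_smul_measure, lintegral_smul_measure, smul_eq_mul,
          smul_eq_mul]
    _ = _ := by rw [h2, h2]

/-- The energy along a linear interpolation is a quadratic polynomial. -/
theorem toReal_interactionEnergy_linInterp {d : ℕ} {W : RSp d → ℝ≥0∞} (hW : Measurable W)
    (hsymm : ∀ x, W (-x) = W x) {ρ σ : Measure (RSp d)} [SFinite ρ] [SFinite σ]
    (h1 : mutualEnergy W ρ ρ ≠ ∞) (h2 : mutualEnergy W ρ σ ≠ ∞) (h3 : mutualEnergy W σ σ ≠ ∞)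
    {t : ℝ} (ht : t ∈ Icc (0 : ℝ) 1) :
    interactionEnergy W (linInterp ρ σ t) ≠ ∞ ∧
    (interactionEnergy W (linInterp ρ σ t)).toReal = 2⁻¹ * ((1 - t) ^ 2 * (mutualEnergy W ρ ρ).toReal
      + 2 * t * (1 - t) * (mutualEnergy W ρ σ).toReal + t ^ 2 * (mutualEnergy W σ σ).toReal) := by
  have ht1 : 0 ≤ 1 - t := by linarith [ht.2]
  rw [interactionEnergy_eq, mutualEnergy_linInterp hW hsymm]
  have hr : ∀ {a b : ℝ≥0∞}, a ≠ ∞ → b ≠ ∞ →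
      (ENNReal.ofReal (1 - t) * a + ENNReal.ofReal t * b).toReal =
        (1 - t) * a.toReal + t * b.toReal := fun ha hb => by
    rw [ENNReal.toReal_add (by finiteness) (by finiteness), ENNReal.toReal_mul, ENNReal.toReal_mul,
      ENNReal.toReal_ofReal ht1, ENNReal.toReal_ofReal ht.1]
  refine ⟨by finiteness, ?_⟩
  rw [ENNReal.toReal_mul, hr (by finiteness) (by finiteness), hr h1 h2, hr h2 h3]
  simp only [ENNReal.toReal_inv, ENNReal.toReal_ofNat]
  ring

/-- Linear interpolation convexity says that the mutual energy of two different measures with the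
same center of mass is less than the sum of their energies. -/
theorem IsLIC.mutualEnergy_lt {d : ℕ} {W : RSp d → ℝ≥0∞} (hLIC : IsLIC W) (hW : Measurable W)
    (hsymm : ∀ x, W (-x) = W x) {ρ σ : Measure (RSp d)} (hρ : IsP2 ρ) (hσ : IsP2 σ) (hne : ρ ≠ σ)
    (hEρ : interactionEnergy W ρ < ∞) (hEσ : interactionEnergy W σ < ∞)
    (hc : centerOfMass ρ = centerOfMass σ) :
    mutualEnergy W ρ σ < interactionEnergy W ρ + interactionEnergy W σ := by
  have := hρ.prob
  have := hσ.prob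
  obtain ⟨hfin, hconv⟩ := hLIC ρ σ hρ hσ hne hEρ hEσ hc
  have h1 : mutualEnergy W ρ ρ ≠ ∞ := by rw [mutualEnergy_self]; finiteness
  have h3 : mutualEnergy W σ σ ≠ ∞ := by rw [mutualEnergy_self]; finiteness
  have h2 : mutualEnergy W ρ σ ≠ ∞ := by
    intro htop
    have h4 := hfin (1 / 2) (by norm_num)
    rw [interactionEnergy_eq, mutualEnergy_linInterp hW hsymm, htop] at h4
    have h5 : ENNReal.ofReal (1 / 2) * ∞ = ∞ := ENNReal.mul_top (by norm_num)
    have h6 : ENNReal.ofReal (1 - 1 / 2) * ∞ = ∞ := ENNReal.mul_top (by norm_num)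
    rw [h5, add_top, h6, top_add, ENNReal.mul_top (by simp)] at h4
    exact lt_irrefl _ h4
  have hE := fun {t : ℝ} (ht : t ∈ Icc (0 : ℝ) 1) =>
    (toReal_interactionEnergy_linInterp hW hsymm h1 h2 h3 ht).2
  have h4 := hconv.2 (left_mem_Icc.2 zero_le_one) (right_mem_Icc.2 zero_le_one) zero_ne_one
    (show (0 : ℝ) < 1 / 2 by norm_num) (show (0 : ℝ) < 1 / 2 by norm_num) (by norm_num)
  simp only [smul_eq_mul] at h4
  rw [hE (by norm_num), hE (by norm_num), hE (by norm_num)] at h4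
  rw [← ENNReal.toReal_lt_toReal h2 (by finiteness), ENNReal.toReal_add hEρ.ne hEσ.ne,
    interactionEnergy_eq, interactionEnergy_eq, ENNReal.toReal_mul, ENNReal.toReal_mul]
  simp only [ENNReal.toReal_inv, ENNReal.toReal_ofNat]
  linarith

/-- Under (LIC), the Euler-Lagrange inequality tested against `σ` makes `σ` a strictly worse
competitor than `ρ`. -/
theorem IsLIC.energy_lt {d : ℕ} {W : RSp d → ℝ≥0∞} (hLIC : IsLIC W) (hW : Measurable W)
    (hsymm : ∀ x, W (-x) = W x) {ρ σ : Measure (RSp d)} (hρ : IsP2 ρ) (hσ : IsP2 σ) (hne : ρ ≠ σ)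
    (hEρ : interactionEnergy W ρ < ∞) (hc : centerOfMass ρ = centerOfMass σ)
    (hEL : mutualEnergy W ρ ρ ≤ mutualEnergy W ρ σ) :
    interactionEnergy W ρ < interactionEnergy W σ := by
  by_contra! hle
  have h1 := hLIC.mutualEnergy_lt hW hsymm hρ hσ hne hEρ (hle.trans_lt hEρ) hc
  have h2 := hEL.trans_lt h1
  rw [mutualEnergy_self, two_mul] at h2
  exact absurd hle (not_le.2 (lt_of_add_lt_add_left h2))

/-- The first variation of the energy at `ρ` in direction `σ` is nonnegative if `ρ` is optimal along
the linear interpolation. -/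
theorem mutualEnergy_le_of_forall_linInterp {d : ℕ} {W : RSp d → ℝ≥0∞} (hW : Measurable W)
    (hsymm : ∀ x, W (-x) = W x) {ρ σ : Measure (RSp d)} [SFinite ρ] [SFinite σ]
    (h1 : mutualEnergy W ρ ρ ≠ ∞) (h2 : mutualEnergy W ρ σ ≠ ∞) (h3 : mutualEnergy W σ σ ≠ ∞)
    (hmin : ∀ t ∈ Ioc (0 : ℝ) 1, interactionEnergy W ρ ≤ interactionEnergy W (linInterp ρ σ t)) :
    mutualEnergy W ρ ρ ≤ mutualEnergy W ρ σ := by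
  rw [← ENNReal.toReal_le_toReal h1 h2]
  set A := (mutualEnergy W ρ ρ).toReal
  set B := (mutualEnergy W ρ σ).toReal
  set C := (mutualEnergy W σ σ).toReal
  have key : ∀ t ∈ Ioc (0 : ℝ) 1, (2 - t) * A ≤ 2 * (1 - t) * B + t * C := by
    intro t ht
    obtain ⟨hne, heq⟩ := toReal_interactionEnergy_linInterp hW hsymm h1 h2 h3 (Ioc_subset_Icc_self ht)
    have h4 := ENNReal.toReal_mono hne (hmin t ht)
    rw [heq, interactionEnergy_eq, ENNReal.toReal_mul] at h4
    simp only [ENNReal.toReal_inv, ENNReal.toReal_ofNat] at h4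
    have h5 : t * ((2 - t) * A) ≤ t * (2 * (1 - t) * B + t * C) := by linarith
    exact le_of_mul_le_mul_left h5 ht.1
  have hl : Tendsto (fun t : ℝ => (2 - t) * A) (𝓝[>] 0) (𝓝 ((2 - 0) * A)) :=
    (Continuous.tendsto (by fun_prop) 0).mono_left nhdsWithin_le_nhds
  have hr : Tendsto (fun t : ℝ => 2 * (1 - t) * B + t * C) (𝓝[>] 0)
      (𝓝 (2 * (1 - 0) * B + 0 * C)) :=
    (Continuous.tendsto (f := fun t : ℝ => 2 * (1 - t) * B + t * C)
      (by fun_prop) 0).mono_left nhdsWithin_le_nhds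
  have := le_of_tendsto_of_tendsto hl hr
    (eventually_of_mem (Ioc_mem_nhdsGT one_pos) key)
  linarith

/-! ### Transport plans moving mass over small distances -/

/-- There is a transport plan from `μ` to `ν` that moves no mass farther than `δ`. -/
def IsTransportClose {d : ℕ} (δ : ℝ≥0∞) (μ ν : Measure (RSp d)) : Prop :=
  ∃ π ∈ transportPlans μ ν, ∀ᵐ p ∂π, edist p.1 p.2 ≤ δ

theorem IsTransportClose.dInf_le {d : ℕ} {δ : ℝ≥0∞} {μ ν : Measure (RSp d)}
    (h : IsTransportClose δ μ ν) : dInf μ ν ≤ δ := by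
  obtain ⟨π, hπ, hae⟩ := h
  refine (iInf₂_le π hπ).trans (iSup₂_le fun p hp => ?_)
  exact Measure.support_subset_of_isClosed
    (isClosed_le (continuous_fst.edist continuous_snd) continuous_const) hae hp

theorem isTransportClose_map {d : ℕ} {δ : ℝ≥0∞} {μ : Measure (RSp d)} {T : RSp d → RSp d}
    (hT : Measurable T) (h : ∀ᵐ x ∂μ, edist x (T x) ≤ δ) : IsTransportClose δ μ (μ.map T) := by
  have hm : Measurable fun x => (x, T x) := measurable_id.prodMk hT
  refine ⟨μ.map fun x => (x, T x), ⟨?_, ?_⟩, ?_⟩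
  · rw [Measure.map_map measurable_fst hm]
    exact Measure.map_id
  · rw [Measure.map_map measurable_snd hm]
    rfl
  · rw [ae_map_iff hm.aemeasurable
      (measurableSet_le (measurable_fst.edist measurable_snd) measurable_const)]
    exact h

theorem IsTransportClose.add {d : ℕ} {δ : ℝ≥0∞} {μ ν μ' ν' : Measure (RSp d)}
    (h : IsTransportClose δ μ ν) (h' : IsTransportClose δ μ' ν') :
    IsTransportClose δ (μ + μ') (ν + ν') := by
  obtain ⟨π, ⟨h1, h2⟩, hae⟩ := h
  obtain ⟨π', ⟨h1', h2'⟩, hae'⟩ := h'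
  refine ⟨π + π', ⟨?_, ?_⟩, ?_⟩
  · rw [Measure.map_add _ _ measurable_fst, h1, h1']
  · rw [Measure.map_add _ _ measurable_snd, h2, h2']
  · rw [ae_add_measure_iff]
    exact ⟨hae, hae'⟩

theorem IsTransportClose.smul {d : ℕ} {δ : ℝ≥0∞} {μ ν : Measure (RSp d)}
    (h : IsTransportClose δ μ ν) (c : ℝ≥0∞) : IsTransportClose δ (c • μ) (c • ν) := by
  obtain ⟨π, ⟨h1, h2⟩, hae⟩ := h
  refine ⟨c • π, ⟨?_, ?_⟩, ?_⟩
  · rw [Measure.map_smul, h1]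
  · rw [Measure.map_smul, h2]
  · exact Measure.ae_smul_measure hae c

theorem isTransportClose_refl {d : ℕ} (δ : ℝ≥0∞) (μ : Measure (RSp d)) : IsTransportClose δ μ μ := by
  simpa using isTransportClose_map (μ := μ) (T := id) measurable_id (ae_of_all _ (by simp))

theorem IsTransportClose.linInterp {d : ℕ} {δ : ℝ≥0∞} {μ ν : Measure (RSp d)}
    (h : IsTransportClose δ μ ν) {t : ℝ} (ht : t ∈ Icc (0 : ℝ) 1) :
    IsTransportClose δ μ (linInterp μ ν t) := by
  have h1 := ((isTransportClose_refl δ μ).smul (ENNReal.ofReal (1 - t))).add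
    (h.smul (ENNReal.ofReal t))
  rwa [← add_smul, ← ENNReal.ofReal_add (by linarith [ht.2]) ht.1, sub_add_cancel,
    ENNReal.ofReal_one, one_smul] at h1

/-- Spreading the mass of `μ` in a small set over a probability measure `ν` concentrated nearby. -/
theorem isTransportClose_prod {d : ℕ} {δ : ℝ≥0∞} {μ ν : Measure (RSp d)} [IsFiniteMeasure μ]
    [IsProbabilityMeasure ν] (h : ∀ᵐ x ∂μ, ∀ᵐ y ∂ν, edist x y ≤ δ) :
    IsTransportClose δ μ (μ univ • ν) := by
  refine ⟨μ.prod ν, ⟨?_, ?_⟩, ?_⟩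
  · rw [Measure.map_fst_prod, measure_univ, one_smul]
  · rw [Measure.map_snd_prod]
  · rwa [Measure.ae_prod_iff_ae_ae
      (measurableSet_le (measurable_fst.edist measurable_snd) measurable_const)]

theorem isProbabilityMeasure_linInterp {d : ℕ} {μ ν : Measure (RSp d)} [IsProbabilityMeasure μ]
    [IsProbabilityMeasure ν] {t : ℝ} (ht : t ∈ Icc (0 : ℝ) 1) :
    IsProbabilityMeasure (linInterp μ ν t) := by
  refine ⟨?_⟩
  rw [linInterp, Measure.add_apply, Measure.smul_apply, Measure.smul_apply, measure_univ,
    measure_univ, smul_eq_mul, smul_eq_mul, mul_one, mul_one,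
    ← ENNReal.ofReal_add (by linarith [ht.2]) ht.1, sub_add_cancel, ENNReal.ofReal_one]

/-- The Euler-Lagrange inequality of a local minimizer, tested against a nearby measure. -/
theorem mutualEnergy_le_of_close {d : ℕ} {W : RSp d → ℝ≥0∞} (hW : Measurable W)
    (hsymm : ∀ x, W (-x) = W x) {ρ σ : Measure (RSp d)} [IsProbabilityMeasure ρ]
    [IsProbabilityMeasure σ] {ε : ℝ≥0∞}
    (hmin : ∀ σ : Measure (RSp d), IsProbabilityMeasure σ → dInf ρ σ < ε →
      interactionEnergy W ρ ≤ interactionEnergy W σ)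
    {δ : ℝ≥0∞} (hδ : δ < ε) (hclose : IsTransportClose δ ρ σ)
    (h1 : mutualEnergy W ρ ρ ≠ ∞) (h2 : mutualEnergy W ρ σ ≠ ∞) (h3 : mutualEnergy W σ σ ≠ ∞) :
    mutualEnergy W ρ ρ ≤ mutualEnergy W ρ σ :=
  mutualEnergy_le_of_forall_linInterp hW hsymm h1 h2 h3 fun _ ht =>
    hmin _ (isProbabilityMeasure_linInterp (Ioc_subset_Icc_self ht))
      ((hclose.linInterp (Ioc_subset_Icc_self ht)).dInf_le.trans_lt hδ)

/-! ### The pointwise Euler-Lagrange inequality -/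

/-- The uniform probability measure on a ball. -/
def ballUnif {d : ℕ} (x : RSp d) (r : ℝ) : Measure (RSp d) :=
  (volume (Metric.ball x r))⁻¹ • volume.restrict (Metric.ball x r)

theorem lintegral_ballUnif {d : ℕ} (f : RSp d → ℝ≥0∞) (x : RSp d) (r : ℝ) :
    ∫⁻ y, f y ∂(ballUnif x r) = ballAvg f x r := by
  rw [ballUnif, lintegral_smul_measure, smul_eq_mul, ballAvg]

theorem isProbabilityMeasure_ballUnif {d : ℕ} (x : RSp d) {r : ℝ} (hr : 0 < r) :
    IsProbabilityMeasure (ballUnif x r) := by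
  refine ⟨?_⟩
  rw [ballUnif, Measure.smul_apply, Measure.restrict_apply_univ, smul_eq_mul,
    ENNReal.inv_mul_cancel (Metric.measure_ball_pos volume x hr).ne' measure_ball_lt_top.ne]

theorem ae_ballUnif_mem {d : ℕ} (x : RSp d) (r : ℝ) : ∀ᵐ y ∂(ballUnif x r), y ∈ Metric.ball x r :=
  Measure.ae_smul_measure (ae_restrict_mem measurableSet_ball) _

/-- The potential of a uniform measure on a ball is bounded on bounded sets. -/
theorem exists_pot_ballUnif_le {d : ℕ} {W : RSp d → ℝ≥0∞} (hHs : SatisfiesHs W) (y₀ : RSp d)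
    {δ : ℝ} (hδ : 0 < δ) (K : ℝ) :
    ∃ C, C ≠ ∞ ∧ ∀ x, ‖x‖ ≤ K → pot W (ballUnif y₀ δ) x ≤ C := by
  refine ⟨(volume (Metric.ball y₀ δ))⁻¹ * ∫⁻ z in Metric.ball 0 (δ + (‖y₀‖ + K)), W z, ?_, ?_⟩
  · exact ENNReal.mul_ne_top (ENNReal.inv_ne_top.2 (Metric.measure_ball_pos volume y₀ hδ).ne')
      (hHs.lintegral_ball_lt_top _).ne
  · intro x hx
    rw [pot, lintegral_ballUnif, ballAvg]
    refine mul_le_mul' le_rfl ?_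
    rw [lintegral_congr fun y => (by rw [← hHs.symm, neg_sub] : W (x - y) = W (y - x)),
      setLIntegral_ball_sub hHs.continuous.measurable]
    refine lintegral_mono_set (Metric.ball_subset_ball' ?_)
    rw [dist_zero_right]
    linarith [norm_sub_le y₀ x]

theorem exists_bound_of_continuous_finite {d : ℕ} {f : RSp d → ℝ≥0∞} (hf : Continuous f)
    (hfin : ∀ x, f x < ∞) (K : ℝ) : ∃ C, C ≠ ∞ ∧ ∀ x, ‖x‖ ≤ K → f x ≤ C := by
  rcases (Metric.closedBall (0 : RSp d) K).eq_empty_or_nonempty with h | h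
  · refine ⟨0, by simp, fun x hx => ?_⟩
    have : x ∈ Metric.closedBall (0 : RSp d) K := by simpa using hx
    simp [h] at this
  · obtain ⟨z, -, hz⟩ := (isCompact_closedBall (0 : RSp d) K).exists_isMaxOn h hf.continuousOn
    exact ⟨f z, (hfin z).ne, fun x hx => hz (by simpa using hx)⟩

theorem lintegral_ne_top_of_bound {d : ℕ} {f : RSp d → ℝ≥0∞} {K : ℝ}
    (hb : ∃ C, C ≠ ∞ ∧ ∀ x, ‖x‖ ≤ K → f x ≤ C) {μ : Measure (RSp d)} [IsFiniteMeasure μ]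
    (hK : ∀ᵐ x ∂μ, ‖x‖ ≤ K) : ∫⁻ x, f x ∂μ ≠ ∞ := by
  obtain ⟨C, hC, hb⟩ := hb
  refine ((lintegral_mono_ae (hK.mono fun x hx => hb x hx)).trans_lt ?_).ne
  rw [lintegral_const]
  exact ENNReal.mul_lt_top hC.lt_top (measure_lt_top _ _)

/-- At the points of its support, the potential of a local minimizer has local minima: otherwise
spreading the mass near such a point over a nearby ball would lower the energy to first order. -/
theorem pot_le_of_mem_support {d : ℕ} {W : RSp d → ℝ≥0∞} (hHs : SatisfiesHs W)
    {ρ : Measure (RSp d)} [IsProbabilityMeasure ρ] {ε : ℝ}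
    (hmin : ∀ σ : Measure (RSp d), IsProbabilityMeasure σ → dInf ρ σ < ENNReal.ofReal ε →
      interactionEnergy W ρ ≤ interactionEnergy W σ)
    {M : ℝ} (hM : ∀ᵐ y ∂ρ, ‖y‖ ≤ M) (hc : Continuous (pot W ρ)) (hfin : ∀ x, pot W ρ x < ∞)
    {p y₀ : RSp d} (hp : p ∈ ρ.support) (hpy : dist p y₀ < ε) : pot W ρ p ≤ pot W ρ y₀ := by
  by_contra! hlt
  have hW := hHs.continuous.measurable
  obtain ⟨c, hc1, hc2⟩ := exists_between hlt
  obtain ⟨c', hc1', hc2'⟩ := exists_between hc2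
  obtain ⟨δ₁, hδ₁, hB₁⟩ := Metric.eventually_nhds_iff.1 (hc.continuousAt.eventually (lt_mem_nhds hc2'))
  obtain ⟨δ₂, hδ₂, hB₂⟩ := Metric.eventually_nhds_iff.1 (hc.continuousAt.eventually (gt_mem_nhds hc1))
  set δ := min (min δ₁ δ₂) ((ε - dist p y₀) / 3) with hδ
  have hδ0 : 0 < δ := lt_min (lt_min hδ₁ hδ₂) (by linarith)
  have hδε : dist p y₀ + 2 * δ < ε := by
    have := min_le_right (min δ₁ δ₂) ((ε - dist p y₀) / 3)
    linarith
  set B := Metric.ball p δ with hB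
  have hBm : MeasurableSet B := measurableSet_ball
  set ν := ballUnif y₀ δ with hν
  have hνprob : IsProbabilityMeasure ν := isProbabilityMeasure_ballUnif y₀ hδ0
  -- The competitor: the mass in `B` is spread uniformly over the ball around `y₀`.
  set σ : Measure (RSp d) := ρ.restrict Bᶜ + ρ B • ν with hσ
  have hσprob : IsProbabilityMeasure σ := by
    refine ⟨?_⟩
    rw [hσ, Measure.add_apply, Measure.smul_apply, Measure.restrict_apply_univ, measure_univ,
      smul_eq_mul, mul_one, add_comm, measure_add_measure_compl hBm, measure_univ]
  have hm0 : ρ B ≠ 0 :=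
    ((Measure.mem_support_iff_forall p).1 hp B (Metric.ball_mem_nhds p hδ0)).ne'
  have hclose : IsTransportClose (ENNReal.ofReal (dist p y₀ + 2 * δ)) ρ σ := by
    have h1 : IsTransportClose (ENNReal.ofReal (dist p y₀ + 2 * δ)) (ρ.restrict B)
        ((ρ.restrict B) univ • ν) := by
      refine isTransportClose_prod ?_
      filter_upwards [ae_restrict_mem hBm] with x hx
      filter_upwards [ae_ballUnif_mem y₀ δ] with y hy
      rw [edist_dist]
      refine ENNReal.ofReal_le_ofReal ?_
      have h2 := dist_triangle4 x p y₀ y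
      rw [Metric.mem_ball] at hx hy
      rw [dist_comm y₀ y] at h2
      linarith
    have h2 := (isTransportClose_refl (ENNReal.ofReal (dist p y₀ + 2 * δ)) (ρ.restrict Bᶜ)).add h1
    rwa [Measure.restrict_apply_univ, add_comm (ρ.restrict Bᶜ) (ρ.restrict B),
      Measure.restrict_add_restrict_compl hBm] at h2
  set K := max M (‖y₀‖ + δ) with hK
  have hMK : ∀ᵐ x ∂ρ, ‖x‖ ≤ K := hM.mono fun x hx => hx.trans (le_max_left _ _)
  have hσK : ∀ᵐ x ∂σ, ‖x‖ ≤ K := by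
    rw [hσ, ae_add_measure_iff]
    refine ⟨ae_restrict_of_ae hMK, Measure.ae_smul_measure ?_ _⟩
    filter_upwards [ae_ballUnif_mem y₀ δ] with y hy
    rw [Metric.mem_ball, dist_eq_norm] at hy
    refine le_trans ?_ (le_max_right _ _)
    linarith [norm_le_norm_add_norm_sub' y y₀]
  obtain ⟨C₁, hC₁, hb₁⟩ := exists_bound_of_continuous_finite hc hfin K
  have hρρ : mutualEnergy W ρ ρ ≠ ∞ := lintegral_ne_top_of_bound ⟨C₁, hC₁, hb₁⟩ hMK
  have hσρ : mutualEnergy W σ ρ ≠ ∞ := lintegral_ne_top_of_bound ⟨C₁, hC₁, hb₁⟩ hσK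
  have hσσ : mutualEnergy W σ σ ≠ ∞ := by
    obtain ⟨C₂, hC₂, hb₂⟩ := exists_pot_ballUnif_le hHs y₀ hδ0 K
    refine lintegral_ne_top_of_bound ⟨C₁ + ρ B * C₂, ?_, fun x hx => ?_⟩ hσK
    · exact ENNReal.add_ne_top.2 ⟨hC₁, ENNReal.mul_ne_top (measure_ne_top _ _) hC₂⟩
    · have h1 : pot W σ x = pot W (ρ.restrict Bᶜ) x + ρ B * pot W ν x := by
        simpa using pot_add_smul W 1 (ρ B) (ρ.restrict Bᶜ) ν x
      rw [h1]
      refine add_le_add ((lintegral_mono' Measure.restrict_le_self le_rfl).trans (hb₁ x hx)) ?_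
      gcongr
      exact hb₂ x hx
  have hEL := mutualEnergy_le_of_close hW hHs.symm hmin
    ((ENNReal.ofReal_lt_ofReal_iff (dist_nonneg.trans_lt hpy)).2 hδε) hclose hρρ
    (by rwa [mutualEnergy_comm hW hHs.symm]) hσσ
  rw [mutualEnergy_comm hW hHs.symm ρ σ] at hEL
  have h1 : mutualEnergy W ρ ρ = ∫⁻ x in Bᶜ, pot W ρ x ∂ρ + ∫⁻ x in B, pot W ρ x ∂ρ := by
    rw [add_comm, lintegral_add_compl _ hBm]; rfl
  have h2 : mutualEnergy W σ ρ = ∫⁻ x in Bᶜ, pot W ρ x ∂ρ + ρ B * ballAvg (pot W ρ) y₀ δ := by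
    rw [mutualEnergy, hσ, lintegral_add_measure, lintegral_smul_measure, lintegral_ballUnif,
      smul_eq_mul]
  have h0 : ∫⁻ x in Bᶜ, pot W ρ x ∂ρ ≠ ∞ := by
    rw [h1] at hρρ
    exact (ENNReal.add_ne_top.1 hρρ).1
  rw [h1, h2, ENNReal.add_le_add_iff_left h0] at hEL
  have h3 : c' * ρ B ≤ ∫⁻ x in B, pot W ρ x ∂ρ := by
    rw [← setLIntegral_const]
    refine setLIntegral_mono' hBm fun x hx => ?_
    exact (hB₁ ((Metric.mem_ball.1 hx).trans_le ((min_le_left _ _).trans (min_le_left _ _)))).le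
  have h4 : ballAvg (pot W ρ) y₀ δ ≤ c := by
    rw [← lintegral_ballUnif]
    have h5 : ∫⁻ y, pot W ρ y ∂ν ≤ ∫⁻ _, c ∂ν := by
      refine lintegral_mono_ae ?_
      filter_upwards [ae_ballUnif_mem y₀ δ] with y hy
      exact (hB₂ ((Metric.mem_ball.1 hy).trans_le ((min_le_left _ _).trans (min_le_right _ _)))).le
    simpa using h5
  have h6 : ρ B * c' ≤ ρ B * c := by
    rw [mul_comm]
    exact h3.trans (hEL.trans (by gcongr))
  exact absurd ((ENNReal.mul_le_mul_iff_right hm0 (measure_ne_top _ _)).1 h6) (not_le.2 hc1')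

/-! ### Radial symmetry -/

theorem centerOfMass_map {d : ℕ} (μ : Measure (RSp d)) (R : RSp d ≃ₗᵢ[ℝ] RSp d) :
    centerOfMass (μ.map R) = R (centerOfMass μ) := by
  rw [centerOfMass, integral_map (f := fun x => x) R.continuous.measurable.aemeasurable
    measurable_id.aestronglyMeasurable]
  exact R.toContinuousLinearEquiv.integral_comp_comm (fun x : RSp d => x)

theorem pot_map_isometry {d : ℕ} {W : RSp d → ℝ≥0∞} (hW : Measurable W)
    (hradial : ∀ x y, ‖x‖ = ‖y‖ → W x = W y) (μ : Measure (RSp d)) (R : RSp d ≃ₗᵢ[ℝ] RSp d)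
    (x : RSp d) : pot W (μ.map R) (R x) = pot W μ x := by
  have hm : Measurable fun y => W (R x - y) := hW.comp (by fun_prop)
  rw [pot, lintegral_map hm R.continuous.measurable]
  refine lintegral_congr fun y => hradial _ _ ?_
  rw [← map_sub, R.norm_map]

theorem mutualEnergy_map_isometry {d : ℕ} {W : RSp d → ℝ≥0∞} (hW : Measurable W)
    (hradial : ∀ x y, ‖x‖ = ‖y‖ → W x = W y) (μ : Measure (RSp d)) [IsFiniteMeasure μ]
    (R : RSp d ≃ₗᵢ[ℝ] RSp d) :
    mutualEnergy W (μ.map R) (μ.map R) = mutualEnergy W μ μ := by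
  rw [mutualEnergy, lintegral_map (measurable_pot hW _) R.continuous.measurable]
  simp_rw [pot_map_isometry hW hradial]
  rfl

theorem IsP2.map_isometry {d : ℕ} {μ : Measure (RSp d)} (h : IsP2 μ) (R : RSp d ≃ₗᵢ[ℝ] RSp d) :
    IsP2 (μ.map R) := by
  have := h.prob
  refine ⟨Measure.isProbabilityMeasure_map R.continuous.measurable.aemeasurable, ?_⟩
  rw [lintegral_map (by fun_prop) R.continuous.measurable]
  simpa using h.second_moment

theorem isP2_of_ae_bound {d : ℕ} {μ : Measure (RSp d)} [IsProbabilityMeasure μ] {M : ℝ}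
    (hM : ∀ᵐ y ∂μ, ‖y‖ ≤ M) : IsP2 μ := by
  refine ⟨inferInstance, ?_⟩
  refine (lintegral_mono_ae (g := fun _ => ENNReal.ofReal M ^ 2) (hM.mono fun y hy => ?_)).trans_lt ?_
  · gcongr
    rw [← ofReal_norm]
    exact ENNReal.ofReal_le_ofReal hy
  · simp

/-- Under (LIC), a local minimizer is invariant under all isometries that are close to the identity
on its support. -/
theorem map_isometry_eq_self {d : ℕ} {W : RSp d → ℝ≥0∞} (hHs : SatisfiesHs W) (hLIC : IsLIC W)
    (hradial : ∀ x y, ‖x‖ = ‖y‖ → W x = W y)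
    {ρ : Measure (RSp d)} [IsProbabilityMeasure ρ] {ε : ℝ}
    (hmin : ∀ σ : Measure (RSp d), IsProbabilityMeasure σ → dInf ρ σ < ENNReal.ofReal ε →
      interactionEnergy W ρ ≤ interactionEnergy W σ)
    {M : ℝ} (hM : ∀ᵐ y ∂ρ, ‖y‖ ≤ M) (hc : Continuous (pot W ρ)) (hfin : ∀ x, pot W ρ x < ∞)
    (hcenter : centerOfMass ρ = 0) (R : RSp d ≃ₗᵢ[ℝ] RSp d) {δ : ℝ} (hδ : 0 ≤ δ) (hδε : δ < ε)
    (hR : ∀ x, ‖x‖ ≤ M → dist x (R x) ≤ δ) : ρ.map R = ρ := by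
  by_contra! hne
  have hW := hHs.continuous.measurable
  have hρ2 : IsP2 ρ := isP2_of_ae_bound hM
  have hσ2 := hρ2.map_isometry R
  have := hσ2.prob
  have hbound := exists_bound_of_continuous_finite hc hfin M
  have hρρ : mutualEnergy W ρ ρ ≠ ∞ := lintegral_ne_top_of_bound hbound hM
  have hσσ : mutualEnergy W (ρ.map R) (ρ.map R) = mutualEnergy W ρ ρ :=
    mutualEnergy_map_isometry hW hradial ρ R
  have hRM : ∀ᵐ y ∂(ρ.map R), ‖y‖ ≤ M := by
    rw [ae_map_iff R.continuous.measurable.aemeasurable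
      (isClosed_le continuous_norm continuous_const).measurableSet]
    simpa using hM
  have hρσ : mutualEnergy W ρ (ρ.map R) ≠ ∞ := by
    rw [mutualEnergy_comm hW hHs.symm]
    exact lintegral_ne_top_of_bound hbound hRM
  have hclose : IsTransportClose (ENNReal.ofReal δ) ρ (ρ.map R) := by
    refine isTransportClose_map R.continuous.measurable (hM.mono fun x hx => ?_)
    rw [edist_dist]
    exact ENNReal.ofReal_le_ofReal (hR x hx)
  have hEL := mutualEnergy_le_of_close hW hHs.symm hmin
    ((ENNReal.ofReal_lt_ofReal_iff (hδ.trans_lt hδε)).2 hδε) hclose hρρ hρσ (by rwa [hσσ])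
  have hlt := hLIC.energy_lt hW hHs.symm hρ2 hσ2 (Ne.symm hne)
    (by rw [interactionEnergy_eq]; finiteness)
    (by rw [centerOfMass_map, hcenter, map_zero]) hEL
  rw [interactionEnergy_eq, interactionEnergy_eq, hσσ] at hlt
  exact lt_irrefl _ hlt

/-- Nearby points on a sphere are exchanged by an isometry close to the identity: the product of the
reflections along `x` and along `x + y` maps `x` to `y`. -/
theorem exists_isometry_near_one {d : ℕ} {x : RSp d} (hx : x ≠ 0) {M δ : ℝ} (hM : 0 ≤ M) (hδ : 0 < δ) :
    ∀ᶠ y in 𝓝 x, ‖x‖ = ‖y‖ → ∃ R : RSp d ≃ₗᵢ[ℝ] RSp d, R x = y ∧ ∀ z, ‖z‖ ≤ M → dist z (R z) ≤ δ := by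
  -- The unit normal `(x + y) / ‖x + y‖` tends to `x / ‖x‖` as `y` tends to `x`.
  set n : RSp d → RSp d := fun y => (‖x + y‖⁻¹ : ℝ) • (x + y) with hn
  have hxx : x + x ≠ 0 := by rw [← two_smul ℝ]; exact smul_ne_zero two_ne_zero hx
  have hnx : n x = (‖x‖⁻¹ : ℝ) • x := by
    simp only [hn]
    rw [← two_smul ℝ x, norm_smul, smul_smul]
    congr 1
    simp only [Real.norm_ofNat]
    have := norm_ne_zero_iff.2 hx
    field_simp
  have hnc : ContinuousAt n x := by
    have hadd : ContinuousAt (fun y => x + y) x := by fun_prop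
    exact (hadd.norm.inv₀ (norm_ne_zero_iff.2 hxx)).smul hadd
  have hev : ∀ᶠ y in 𝓝 x, ‖n y - n x‖ ≤ δ / (4 * (M + 1)) := by
    have h1 := Metric.continuousAt_iff'.1 hnc (δ / (4 * (M + 1))) (by positivity)
    exact h1.mono fun y hy => by rw [← dist_eq_norm]; exact hy.le
  have hne : ∀ᶠ y in 𝓝 x, x + y ≠ 0 :=
    (by fun_prop : ContinuousAt (fun y => x + y) x).eventually_ne hxx
  filter_upwards [hev, hne] with y hy hxy hnorm
  set S := Submodule.reflection (ℝ ∙ x)ᗮ with hS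
  set T := Submodule.reflection (ℝ ∙ (-x - y))ᗮ with hT
  have hrefl : ∀ (u z : RSp d), u ≠ 0 → Submodule.reflection (ℝ ∙ u)ᗮ z =
      z - (2 * inner ℝ ((‖u‖⁻¹ : ℝ) • u) z) • ((‖u‖⁻¹ : ℝ) • u) := by
    intro u z hu
    rw [Submodule.reflection_orthogonal_apply, Submodule.reflection_singleton_apply]
    simp only [RCLike.ofReal_real_eq_id, id_eq, inner_smul_left, conj_trivial, smul_smul]
    have := norm_ne_zero_iff.2 hu
    rw [two_smul, ← add_smul, neg_sub]
    congr 2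
    field_simp
    ring
  have hunit : ∀ u : RSp d, u ≠ 0 → ‖(‖u‖⁻¹ : ℝ) • u‖ = 1 := fun u hu => by
    rw [norm_smul, norm_inv, norm_norm, inv_mul_cancel₀ (norm_ne_zero_iff.2 hu)]
  refine ⟨S.trans T, ?_, fun z hz => ?_⟩
  · have h1 : S x = -x := Submodule.reflection_orthogonalComplement_singleton_eq_neg x
    rw [LinearIsometryEquiv.trans_apply, h1]
    exact Submodule.reflection_sub (by rwa [norm_neg])
  · rw [LinearIsometryEquiv.trans_apply]
    set w := S z with hw
    have hSw : S w = z := Submodule.reflection_reflection _ z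
    have hwn : ‖w‖ ≤ M := by rw [hw, S.norm_map]; exact hz
    have h1 : dist z (T w) = ‖(2 * inner ℝ (n y) w) • n y - (2 * inner ℝ (n x) w) • n x‖ := by
      have hneg : -x - y = -(x + y) := by abel
      have hn' : (‖-x - y‖⁻¹ : ℝ) • (-x - y) = -n y := by rw [hneg, norm_neg, smul_neg]
      rw [← hSw, dist_eq_norm, hS, hT, hrefl x w hx,
        hrefl (-x - y) w (by rw [hneg]; exact neg_ne_zero.2 hxy), hn', ← hnx, inner_neg_left,
        mul_neg, neg_smul, smul_neg, neg_neg]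
      congr 1
      abel
    have h2 : (2 * inner ℝ (n y) w) • n y - (2 * inner ℝ (n x) w) • n x =
        (2 * inner ℝ (n y - n x) w) • n y + (2 * inner ℝ (n x) w) • (n y - n x) := by
      rw [inner_sub_left, smul_sub, mul_sub, sub_smul]; abel
    have hny : ‖n y‖ = 1 := hunit _ hxy
    have hnx1 : ‖n x‖ = 1 := hunit _ hxx
    have h3 : |inner ℝ (n y - n x) w| ≤ ‖n y - n x‖ * M :=
      (abs_real_inner_le_norm _ _).trans (by gcongr)
    have h4 : |inner ℝ (n x) w| ≤ M :=
      (abs_real_inner_le_norm _ _).trans (by rw [hnx1, one_mul]; exact hwn)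
    rw [h1, h2]
    refine (norm_add_le _ _).trans ?_
    rw [norm_smul _ (n y), norm_smul _ (n y - n x), hny, Real.norm_eq_abs, Real.norm_eq_abs, abs_mul,
      abs_mul, abs_two]
    have h5 : 4 * (M + 1) * ‖n y - n x‖ ≤ δ := by
      have := (le_div_iff₀' (by positivity)).1 hy
      linarith
    have h6 := norm_nonneg (n y - n x)
    nlinarith [mul_le_mul_of_nonneg_right h4 h6]

/-! ### Minimality of the potential on the support -/

/-- The properties of the potential `V` of a local minimizer with support `S` from which `V` is shown
to be minimal on `S`. In dimension one no symmetry is required. -/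
structure IsSupportPotential {d : ℕ} (V : RSp d → ℝ) (S : Set (RSp d)) : Prop where
  contDiff : ContDiff ℝ 1 V
  smooth : ∀ x, x ∉ S → ContDiffAt ℝ 4 V x
  bilaplacian_neg : ∀ x, x ∉ S → Δ (Δ V) x < 0
  laplacian_pos : ∃ R : ℝ, ∀ x, R < ‖x‖ → 0 < Δ V x
  localMin : ∃ ε > 0, ∀ p ∈ S, ∀ y, dist p y < ε → V p ≤ V y
  isCompact : IsCompact S
  nonempty : S.Nonempty
  radial : d = 1 ∨ (2 ≤ d ∧ (∀ x y, ‖x‖ = ‖y‖ → V x = V y) ∧ ∀ x y, ‖x‖ = ‖y‖ → x ∈ S → y ∈ S)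

namespace IsSupportPotential

variable {d : ℕ} {V : RSp d → ℝ} {S : Set (RSp d)}

theorem fderiv_eq_zero (h : IsSupportPotential V S) {p : RSp d} (hp : p ∈ S) : fderiv ℝ V p = 0 := by
  obtain ⟨ε, hε, hmin⟩ := h.localMin
  have : IsLocalMin V p := by
    filter_upwards [Metric.ball_mem_nhds p hε] with y hy
    exact hmin p hp y (by rwa [dist_comm])
  exact this.fderiv_eq_zero

theorem continuous_ray (h : IsSupportPotential V S) (e : RSp d) :
    Continuous fun r : ℝ => V (r • e) :=
  h.contDiff.continuous.comp (by fun_prop)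

theorem continuous_flux (h : IsSupportPotential V S) (e : RSp d) :
    Continuous fun r : ℝ => r ^ (d - 1) * fderiv ℝ V (r • e) e := by
  have h1 : Continuous fun r : ℝ => fderiv ℝ V (r • e) :=
    (h.contDiff.continuous_fderiv (by simp)).comp (by fun_prop)
  exact (continuous_pow _).mul (h1.clm_apply continuous_const)

theorem hasDerivAt (h : IsSupportPotential V S) (e : RSp d) (r : ℝ) :
    HasDerivAt (fun s : ℝ => V (s • e)) (fderiv ℝ V (r • e) e) r :=
  hasDerivAt_ray (h.contDiff.differentiable (by simp) _)

theorem local_min_ray (h : IsSupportPotential V S) {e : RSp d} (he : ‖e‖ = 1) {a : ℝ}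
    (ha : a • e ∈ S) : ∃ δ > 0, ∀ r, |r - a| < δ → V (a • e) ≤ V (r • e) := by
  obtain ⟨ε, hε, hmin⟩ := h.localMin
  refine ⟨ε, hε, fun r hr => hmin _ ha _ ?_⟩
  rwa [dist_comm, dist_eq_norm, ← sub_smul, norm_smul, he, mul_one, Real.norm_eq_abs]

theorem pow_pos_of (h : IsSupportPotential V S) {r : ℝ} (hr : d = 1 ∨ 0 < r) :
    0 < r ^ (d - 1) := by
  rcases hr with rfl | hr
  · simp
  · exact pow_pos hr _

theorem radial_of (h : IsSupportPotential V S) {I : Set ℝ} (hI : d = 1 ∨ ∀ r ∈ I, 0 < r) :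
    d = 1 ∨ ((∀ r ∈ I, 0 < r) ∧ ∀ x y, ‖x‖ = ‖y‖ → V x = V y) := by
  rcases h.radial with h1 | h1
  · exact Or.inl h1
  · exact hI.imp_right fun h2 => ⟨h2, h1.2.1⟩

theorem hasDerivAt_flux_gap (h : IsSupportPotential V S) {e : RSp d} (he : ‖e‖ = 1) {I : Set ℝ}
    (hI : d = 1 ∨ ∀ r ∈ I, 0 < r) (hS : ∀ r ∈ I, r • e ∉ S) :
    ∀ r ∈ I, HasDerivAt (fun s : ℝ => s ^ (d - 1) * fderiv ℝ V (s • e) e)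
      (r ^ (d - 1) * Δ V (r • e)) r := fun r hr =>
  hasDerivAt_flux he ((h.smooth _ (hS r hr)).of_le (by norm_num))
    ((h.radial_of hI).imp_right fun h1 => ⟨h1.1 r hr, h1.2⟩)

theorem hasDerivAt_laplacian_gap (h : IsSupportPotential V S) {e : RSp d} {I : Set ℝ}
    (hS : ∀ r ∈ I, r • e ∉ S) :
    ∀ r ∈ I, HasDerivAt (fun s : ℝ => Δ V (s • e)) (fderiv ℝ (Δ V) (r • e) e) r := fun r hr =>
  hasDerivAt_ray ((contDiffAt_laplacian (n := 2) (h.smooth _ (hS r hr))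
    (by norm_num)).differentiableAt (by simp))

theorem strictAntiOn_gap (h : IsSupportPotential V S) {e : RSp d} (he : ‖e‖ = 1) {I : Set ℝ}
    (hIo : IsOpen I) (hIc : Convex ℝ I) (hI : d = 1 ∨ ∀ r ∈ I, 0 < r)
    (hS : ∀ r ∈ I, r • e ∉ S) :
    StrictAntiOn (fun r : ℝ => r ^ (d - 1) * fderiv ℝ (Δ V) (r • e) e) I :=
  strictAntiOn_flux_laplacian he hIo hIc (fun r hr => h.smooth _ (hS r hr)) (h.radial_of hI)
    (fun r hr => h.pow_pos_of (hI.imp_right fun h1 => h1 r hr))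
    fun r hr => h.bilaplacian_neg _ (hS r hr)

/-- The support has no bounded gap along a ray: neither between two points of the support, nor
between the origin and the support. -/
theorem no_gap (h : IsSupportPotential V S) {e : RSp d} (he : ‖e‖ = 1) {a b : ℝ} (hab : a < b)
    (hI : d = 1 ∨ 0 ≤ a) (ha : a • e ∈ S ∨ (2 ≤ d ∧ a = 0)) (hb : b • e ∈ S)
    (hS : ∀ r ∈ Ioo a b, r • e ∉ S) : False := by
  have hI' : d = 1 ∨ ∀ r ∈ Ioo a b, 0 < r := hI.imp_right fun h1 r hr => h1.trans_lt hr.1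
  have hz := h.strictAntiOn_gap he isOpen_Ioo (convex_Ioo a b) hI' hS
  refine no_bounded_gap hab (m := fun r => r ^ (d - 1)) (v := fun r => V (r • e))
    (v' := fun r => fderiv ℝ V (r • e) e) (u := fun r => Δ V (r • e))
    (u' := fun r => fderiv ℝ (Δ V) (r • e) e)
    (fun r hr => h.pow_pos_of (hI'.imp_right fun h1 => h1 r hr)) (fun r _ => h.hasDerivAt e r)
    (h.continuous_ray e).continuousOn (h.continuous_flux e).continuousOn
    (h.hasDerivAt_flux_gap he hI' hS) (h.hasDerivAt_laplacian_gap hS) hz ?_ ?_ ?_ ?_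
  · rcases ha with ha | ⟨hd, rfl⟩
    · simp [h.fderiv_eq_zero ha]
    · rw [zero_pow (by omega), zero_mul]
  · simp [h.fderiv_eq_zero hb]
  · by_cases haS : a • e ∈ S
    · obtain ⟨δ, hδ, hmin⟩ := h.local_min_ray he haS
      refine Or.inl ⟨δ, hδ, fun r hr => hmin r ?_⟩
      rw [abs_of_pos (by linarith [hr.1])]
      linarith [hr.2]
    · -- Near the origin `V` is smooth, so the flux of `Δ V` starts from zero and decreases.
      obtain ⟨hd, rfl⟩ := ha.resolve_left haS
      refine Or.inr fun r hr => ?_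
      have hcont : ContinuousAt (fun s : ℝ => s ^ (d - 1) * fderiv ℝ (Δ V) (s • e) e) 0 := by
        have h1 : ContinuousAt (fderiv ℝ (Δ V)) ((0 : ℝ) • e) :=
          ((contDiffAt_laplacian (n := 2) (h.smooth _ haS) (by norm_num)).fderiv_right (m := 1)
            (by norm_num)).continuousAt
        have h2 : ContinuousAt (fun s : ℝ => fderiv ℝ (Δ V) (s • e)) 0 :=
          ContinuousAt.comp (f := fun s : ℝ => s • e) h1 (by fun_prop)
        exact (continuousAt_id.pow _).mul (h2.clm_apply continuousAt_const)
      have hlim : Tendsto (fun s : ℝ => s ^ (d - 1) * fderiv ℝ (Δ V) (s • e) e) (𝓝[>] 0) (𝓝 0) := by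
        have h1 := hcont.tendsto.mono_left (nhdsWithin_le_nhds (s := Ioi (0 : ℝ)))
        rwa [zero_pow (by omega), zero_mul] at h1
      refine ge_of_tendsto hlim ?_
      filter_upwards [Ioo_mem_nhdsGT hr.1] with s hs
      exact (hz ⟨hs.1, hs.2.trans hr.2⟩ hr hs.2).le
  · obtain ⟨δ, hδ, hmin⟩ := h.local_min_ray he hb
    refine ⟨δ, hδ, fun r hr => hmin r ?_⟩
    rw [abs_of_neg (by linarith [hr.2])]
    linarith [hr.1]

/-- Along a ray, the potential grows outside the support. -/
theorem le_of_unbounded (h : IsSupportPotential V S) {e : RSp d} (he : ‖e‖ = 1) {a : ℝ}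
    (hI : d = 1 ∨ 0 ≤ a) (ha : a • e ∈ S) (hS : ∀ r ∈ Ioi a, r • e ∉ S) :
    ∀ r, a ≤ r → V (a • e) ≤ V (r • e) := by
  have hI' : d = 1 ∨ ∀ r ∈ Ioi a, 0 < r := hI.imp_right fun h1 r hr => h1.trans_lt hr
  refine le_of_unbounded_gap (m := fun r => r ^ (d - 1)) (v := fun r => V (r • e))
    (v' := fun r => fderiv ℝ V (r • e) e) (u := fun r => Δ V (r • e))
    (u' := fun r => fderiv ℝ (Δ V) (r • e) e)
    (fun r hr => h.pow_pos_of (hI'.imp_right fun h1 => h1 r hr)) (fun r _ => h.hasDerivAt e r)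
    (h.continuous_ray e).continuousOn (h.continuous_flux e).continuousOn
    (h.hasDerivAt_flux_gap he hI' hS) (h.hasDerivAt_laplacian_gap hS)
    (h.strictAntiOn_gap he isOpen_Ioi (convex_Ioi a) hI' hS) ?_ ?_ ?_
  · simp [h.fderiv_eq_zero ha]
  · obtain ⟨δ, hδ, hmin⟩ := h.local_min_ray he ha
    refine ⟨δ, hδ, fun r hr => hmin r ?_⟩
    rw [abs_of_pos (by linarith [hr.1])]
    linarith [hr.2]
  · obtain ⟨R, hR⟩ := h.laplacian_pos
    refine ⟨|R|, fun r hr => hR _ ?_⟩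
    rw [norm_smul, he, mul_one, Real.norm_eq_abs]
    exact (le_abs_self R).trans_lt (hr.trans_le (le_abs_self r))

theorem isCompact_ray (h : IsSupportPotential V S) {e : RSp d} (he : ‖e‖ = 1) {J : Set ℝ}
    (hJ : IsClosed J) : IsCompact {r : ℝ | r ∈ J ∧ r • e ∈ S} := by
  obtain ⟨R, hR⟩ := h.isCompact.isBounded.exists_norm_le
  refine (isCompact_Icc (a := -R) (b := R)).of_isClosed_subset
    (hJ.inter (h.isCompact.isClosed.preimage (by fun_prop))) fun r hr => ?_
  have h1 := hR _ hr.2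
  rw [norm_smul, he, mul_one, Real.norm_eq_abs] at h1
  exact abs_le.1 h1

/-- The support meets a ray (a line, in dimension one) in an interval. -/
theorem ordConnected_ray (h : IsSupportPotential V S) {e : RSp d} (he : ‖e‖ = 1) {J : Set ℝ}
    (hJ : IsClosed J) (hJo : J.OrdConnected) (hJ0 : d = 1 ∨ ∀ r ∈ J, 0 ≤ r) :
    {r : ℝ | r ∈ J ∧ r • e ∈ S}.OrdConnected := by
  set T := {r : ℝ | r ∈ J ∧ r • e ∈ S} with hT
  have hTc : IsCompact T := h.isCompact_ray he hJ
  refine ⟨fun a ha b hb c hc => ?_⟩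
  by_contra hcT
  -- The points of the ray next to a missing point `c` bound a gap of the support.
  have h1 : IsCompact (T ∩ Iic c) := hTc.inter_right isClosed_Iic
  have h2 : IsCompact (T ∩ Ici c) := hTc.inter_right isClosed_Ici
  obtain ⟨a', ha', hamax⟩ := h1.exists_isGreatest ⟨a, ha, hc.1⟩
  obtain ⟨b', hb', hbmin⟩ := h2.exists_isLeast ⟨b, hb, hc.2⟩
  have hac : a' < c := lt_of_le_of_ne ha'.2 (by rintro rfl; exact hcT ha'.1)
  have hcb : c < b' := lt_of_le_of_ne hb'.2 (by rintro rfl; exact hcT hb'.1)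
  refine h.no_gap he (hac.trans hcb) (hJ0.imp_right fun h3 => h3 _ ha'.1.1) (Or.inl ha'.1.2)
    hb'.1.2 fun r hr hrS => ?_
  have hrJ : r ∈ J := hJo.out ha'.1.1 hb'.1.1 (Ioo_subset_Icc_self hr)
  rcases le_total r c with h3 | h3
  · exact absurd (hamax ⟨⟨hrJ, hrS⟩, h3⟩) (not_le.2 hr.1)
  · exact absurd (hbmin ⟨⟨hrJ, hrS⟩, h3⟩) (not_le.2 hr.2)

/-- The potential is constant on the part of the support on a ray. -/
theorem eq_on_ray (h : IsSupportPotential V S) {e : RSp d} (he : ‖e‖ = 1) {J : Set ℝ}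
    (hJ : IsClosed J) (hJo : J.OrdConnected) (hJ0 : d = 1 ∨ ∀ r ∈ J, 0 ≤ r) {a b : ℝ}
    (haJ : a ∈ J) (hbJ : b ∈ J) (ha : a • e ∈ S) (hb : b • e ∈ S) : V (a • e) = V (b • e) := by
  wlog hab : a ≤ b generalizing a b
  · exact (this hbJ haJ hb ha (le_of_not_ge hab)).symm
  have hsub : ∀ r ∈ Icc a b, r • e ∈ S := fun r hr =>
    ((h.ordConnected_ray he hJ hJo hJ0).out ⟨haJ, ha⟩ ⟨hbJ, hb⟩ hr).2
  refine (constant_of_has_deriv_right_zero (f := fun r : ℝ => V (r • e))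
    (h.continuous_ray e).continuousOn (fun r hr => ?_) b (right_mem_Icc.2 hab)).symm
  have h1 := h.hasDerivAt e r
  rw [h.fderiv_eq_zero (hsub r (Ico_subset_Icc_self hr))] at h1
  simpa using h1.hasDerivWithinAt

/-- The potential attains its global minimum at every point of the support. -/
theorem le (h : IsSupportPotential V S) {p : RSp d} (hp : p ∈ S) (x : RSp d) : V p ≤ V x := by
  rcases h.radial with rfl | ⟨hd, hVrad, hSrad⟩
  · set e : RSp 1 := EuclideanSpace.single 0 1 with he'
    have he : ‖e‖ = 1 := by simp [he']
    have hrep : ∀ z : RSp 1, z = z 0 • e := fun z => by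
      ext i
      fin_cases i
      simp [he']
    have hT := h.isCompact_ray he isClosed_univ
    have hpT : p 0 ∈ {r : ℝ | r ∈ univ ∧ r • e ∈ S} := ⟨mem_univ _, by rwa [← hrep]⟩
    obtain ⟨b, hb, hbmax⟩ := hT.exists_isGreatest ⟨_, hpT⟩
    obtain ⟨a, ha, hamin⟩ := hT.exists_isLeast ⟨_, hpT⟩
    have hconst : ∀ r : ℝ, r • e ∈ S → V p = V (r • e) := fun r hr => by
      conv_lhs => rw [hrep p]
      exact h.eq_on_ray he isClosed_univ ordConnected_univ (Or.inl rfl) (mem_univ _) (mem_univ _)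
        hpT.2 hr
    rw [hrep x]
    rcases le_total b (x 0) with hbx | hbx
    · rw [hconst b hb.2]
      exact h.le_of_unbounded he (Or.inl rfl) hb.2
        (fun r hr hrS => absurd (hbmax ⟨mem_univ _, hrS⟩) (not_le.2 hr)) _ hbx
    rcases le_total a (x 0) with hax | hax
    · exact (hconst _ ((h.ordConnected_ray he isClosed_univ ordConnected_univ (Or.inl rfl)).out
        ha hb ⟨hax, hbx⟩).2).le
    · have h1 := h.le_of_unbounded (e := -e) (by rwa [norm_neg]) (a := -a) (Or.inl rfl)
        (by simpa using ha.2)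
        (fun r hr hrS => absurd (hamin ⟨mem_univ _, (by simpa using hrS : (-r) • e ∈ S)⟩)
          (not_le.2 (neg_lt.1 hr))) (-x 0) (neg_le_neg hax)
      rw [hconst a ha.2]
      simpa using h1
  · have : Nonempty (Fin d) := ⟨⟨0, by omega⟩⟩
    obtain ⟨e, he⟩ := exists_norm_eq (RSp d) (zero_le_one' ℝ)
    have hnorm : ∀ z : RSp d, ‖z‖ = ‖‖z‖ • e‖ := fun z => by rw [norm_smul, he, norm_norm, mul_one]
    have hT := h.isCompact_ray he (isClosed_Ici (a := (0 : ℝ)))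
    have hJ0 : d = 1 ∨ ∀ r ∈ Ici (0 : ℝ), 0 ≤ r := Or.inr fun r hr => hr
    have hpT : ‖p‖ ∈ {r : ℝ | r ∈ Ici 0 ∧ r • e ∈ S} := ⟨norm_nonneg _, hSrad _ _ (hnorm p) hp⟩
    obtain ⟨b, hb, hbmax⟩ := hT.exists_isGreatest ⟨_, hpT⟩
    obtain ⟨a, ha, hamin⟩ := hT.exists_isLeast ⟨_, hpT⟩
    -- The support reaches the origin.
    have ha0 : a = 0 := by
      by_contra hne
      have hapos : 0 < a := lt_of_le_of_ne ha.1 (Ne.symm hne)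
      exact h.no_gap he hapos (Or.inr le_rfl) (Or.inr ⟨hd, rfl⟩) ha.2 fun r hr hrS =>
        absurd (hamin ⟨hr.1.le, hrS⟩) (not_le.2 hr.2)
    have hconst : ∀ r : ℝ, 0 ≤ r → r • e ∈ S → V p = V (r • e) := fun r hr0 hr => by
      rw [hVrad _ _ (hnorm p)]
      exact h.eq_on_ray he isClosed_Ici ordConnected_Ici hJ0 hpT.1 hr0 hpT.2 hr
    rw [hVrad _ _ (hnorm x)]
    rcases le_total b ‖x‖ with hbx | hbx
    · rw [hconst b hb.1 hb.2]
      exact h.le_of_unbounded he (Or.inr hb.1) hb.2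
        (fun r hr hrS => absurd (hbmax ⟨mem_Ici.2 ((mem_Ici.1 hb.1).trans (le_of_lt hr)), hrS⟩) (not_le.2 hr)) _ hbx
    · exact (hconst _ (norm_nonneg x) ((h.ordConnected_ray he isClosed_Ici ordConnected_Ici hJ0).out
        ha hb ⟨ha0.le.trans (norm_nonneg x), hbx⟩).2).le

end IsSupportPotential

/-! ### Smoothness of the potential off the support -/

/-- Cutting off a function that is smooth away from the origin, near the origin and near infinity. -/
theorem exists_cutoff {d : ℕ} {f : RSp d → ℝ} (hf : ∀ x, x ≠ 0 → ContDiffAt ℝ 4 f x) {a L : ℝ}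
    (ha : 0 < a) (haL : a < L) :
    ∃ g : RSp d → ℝ, ContDiff ℝ 4 g ∧ HasCompactSupport g ∧ ∀ z, a < ‖z‖ → ‖z‖ < L → g z = f z := by
  set c₁ : ContDiffBump (0 : RSp d) := ⟨L, L + 1, ha.trans haL, by linarith⟩ with hc₁
  set c₂ : ContDiffBump (0 : RSp d) := ⟨a / 2, a, by linarith, by linarith⟩ with hc₂
  have hout : ∀ z : RSp d, L + 1 ≤ ‖z‖ → c₁ z = 0 ∧ c₂ z = 0 := fun z hz =>
    ⟨c₁.zero_of_le_dist (by rw [dist_zero_right]; exact hz),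
      c₂.zero_of_le_dist (by rw [dist_zero_right]; exact (by linarith : a ≤ ‖z‖))⟩
  refine ⟨fun z => (c₁ z - c₂ z) * f z, ?_, ?_, fun z hz hz' => ?_⟩
  · rw [contDiff_iff_contDiffAt]
    intro z
    rcases eq_or_ne z 0 with rfl | hz
    · have h0 : (fun z => (c₁ z - c₂ z) * f z) =ᶠ[𝓝 0] fun _ => 0 := by
        filter_upwards [Metric.closedBall_mem_nhds (0 : RSp d) (half_pos ha)] with z hz
        rw [c₂.one_of_mem_closedBall hz, c₁.one_of_mem_closedBall, sub_self, zero_mul]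
        exact Metric.closedBall_subset_closedBall (by simp only [hc₁]; linarith) hz
      exact contDiffAt_const.congr_of_eventuallyEq h0
    · exact (c₁.contDiff.contDiffAt.sub c₂.contDiff.contDiffAt).mul (hf z hz)
  · refine HasCompactSupport.intro (isCompact_closedBall (0 : RSp d) (L + 1)) fun z hz => ?_
    rw [mem_closedBall_zero_iff, not_le] at hz
    rw [(hout z hz.le).1, (hout z hz.le).2, sub_self, zero_mul]
  · change (c₁ z - c₂ z) * f z = f z
    rw [c₁.one_of_mem_closedBall (by rw [mem_closedBall_zero_iff]; exact hz'.le),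
      c₂.zero_of_le_dist (by rw [dist_zero_right]; exact hz.le), sub_zero, one_mul]

/-- Off the support the potential is smooth, and its Laplacian and bi-Laplacian are obtained by
differentiating under the integral. -/
theorem pot_off_support {d : ℕ} {W : RSp d → ℝ≥0∞} (hHs : SatisfiesHs W)
    (hC4 : ContDiffOn ℝ 4 (realPotential W) {0}ᶜ) {ρ : Measure (RSp d)} [IsProbabilityMeasure ρ]
    {M : ℝ} (hM : ∀ᵐ y ∂ρ, ‖y‖ ≤ M) {x₀ : RSp d} (hx₀ : x₀ ∉ ρ.support) :
    ContDiffAt ℝ 4 (fun x => (pot W ρ x).toReal) x₀ ∧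
    (Integrable (fun y => Δ (realPotential W) (x₀ - y)) ρ ∧
      Δ (fun x => (pot W ρ x).toReal) x₀ = ∫ y, Δ (realPotential W) (x₀ - y) ∂ρ) ∧
    (Integrable (fun y => Δ (Δ (realPotential W)) (x₀ - y)) ρ ∧
      Δ (Δ (fun x => (pot W ρ x).toReal)) x₀ = ∫ y, Δ (Δ (realPotential W)) (x₀ - y) ∂ρ) := by
  have hW := hHs.continuous.measurable
  obtain ⟨ε, hε, hball⟩ := Metric.isOpen_iff.1 Measure.isOpen_compl_support x₀ hx₀
  set a := ε / 2 with ha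
  have ha0 : 0 < a := half_pos hε
  set L := |M| + ‖x₀‖ + a + a with hL
  have haL : a < L := by
    have := abs_nonneg M
    have := norm_nonneg x₀
    linarith
  -- For `x` near `x₀` only the values of `W` on a compact shell `A` around the origin matter.
  obtain ⟨g, hg, hgs, hgf⟩ := exists_cutoff (fun x hx => contDiffAt_realPotential hC4 hx) ha0 haL
  have hsupp : ∀ᵐ y ∂ρ, y ∈ ρ.support := Measure.support_mem_ae
  set A : Set (RSp d) := {z | a < ‖z‖ ∧ ‖z‖ < L} with hA
  have hAo : IsOpen A :=
    (isOpen_lt continuous_const continuous_norm).inter (isOpen_lt continuous_norm continuous_const)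
  have hmem : ∀ᵐ y ∂ρ, ∀ x ∈ Metric.ball x₀ a, x - y ∈ A := by
    filter_upwards [hM, hsupp] with y hyM hyS x hx
    rw [Metric.mem_ball] at hx
    have h1 : ε ≤ dist x₀ y := by
      by_contra! hlt
      exact hball (by rwa [Metric.mem_ball, dist_comm]) hyS
    have h2 := dist_triangle x₀ x y
    rw [dist_comm x₀ x] at h2
    have h3 := norm_sub_le x y
    have h4 : ‖x‖ < ‖x₀‖ + a := by
      rw [dist_eq_norm] at hx
      linarith [norm_le_norm_add_norm_sub' x x₀]
    rw [dist_eq_norm x y] at h2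
    have h5 := le_abs_self M
    exact ⟨by linarith, by linarith⟩
  have hVg : ∀ x ∈ Metric.ball x₀ a, (pot W ρ x).toReal = ∫ y, g (x - y) ∂ρ := by
    intro x hx
    have hm : Measurable fun y => W (x - y) := hW.comp (by fun_prop)
    have hlt : ∀ᵐ y ∂ρ, W (x - y) < ∞ := by
      filter_upwards [hmem] with y hy
      exact (hHs.ne_top (norm_pos_iff.1 (ha0.trans (hy x hx).1))).lt_top
    rw [pot, ← integral_toReal hm.aemeasurable hlt]
    refine integral_congr_ae ?_
    filter_upwards [hmem] with y hy
    exact (hgf _ (hy x hx).1 (hy x hx).2).symm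
  have hev : (fun x => (pot W ρ x).toReal) =ᶠ[𝓝 x₀] fun x => ∫ y, g (x - y) ∂ρ :=
    eventually_of_mem (Metric.ball_mem_nhds x₀ ha0) hVg
  have hgfA : ∀ z ∈ A, g =ᶠ[𝓝 z] realPotential W := fun z hz =>
    eventually_of_mem (hAo.mem_nhds hz) fun w hw => hgf w hw.1 hw.2
  have hg2 : ContDiff ℝ 2 g := hg.of_le (by norm_num)
  have hΔg : ContDiff ℝ 2 (Δ g) :=
    contDiff_iff_contDiffAt.2 fun x => contDiffAt_laplacian hg.contDiffAt (by norm_num)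
  have hΔgs := hasCompactSupport_laplacian hgs
  have hΔΔg : ContDiff ℝ 0 (Δ (Δ g)) :=
    contDiff_iff_contDiffAt.2 fun x => contDiffAt_laplacian hΔg.contDiffAt (by norm_num)
  have hx₀b : x₀ ∈ Metric.ball x₀ a := Metric.mem_ball_self ha0
  have heq1 : (fun y => Δ g (x₀ - y)) =ᵐ[ρ] fun y => Δ (realPotential W) (x₀ - y) := by
    filter_upwards [hmem] with y hy
    exact (laplacian_congr_nhds (hgfA _ (hy x₀ hx₀b))).eq_of_nhds
  have heq2 : (fun y => Δ (Δ g) (x₀ - y)) =ᵐ[ρ] fun y => Δ (Δ (realPotential W)) (x₀ - y) := by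
    filter_upwards [hmem] with y hy
    exact (laplacian_congr_nhds (laplacian_congr_nhds (hgfA _ (hy x₀ hx₀b)))).eq_of_nhds
  have hΔconv : Δ (fun x => ∫ y, g (x - y) ∂ρ) = fun x => ∫ y, Δ g (x - y) ∂ρ :=
    funext fun x => laplacian_integral_translate hg2 hgs x
  refine ⟨?_, ⟨(integrable_translate hΔg.continuous hΔgs x₀).congr heq1, ?_⟩,
    ⟨(integrable_translate hΔΔg.continuous (hasCompactSupport_laplacian hΔgs) x₀).congr heq2, ?_⟩⟩
  · exact (contDiff_integral_translate 4 hg hgs).contDiffAt.congr_of_eventuallyEq hev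
  · rw [(laplacian_congr_nhds hev).eq_of_nhds, hΔconv]
    exact integral_congr_ae heq1
  · rw [(laplacian_congr_nhds (laplacian_congr_nhds hev)).eq_of_nhds, hΔconv,
      laplacian_integral_translate hΔg hΔgs]
    exact integral_congr_ae heq2

theorem integral_pos_of_ae_pos {d : ℕ} {ρ : Measure (RSp d)} [IsProbabilityMeasure ρ]
    {f : RSp d → ℝ} (hf : Integrable f ρ) (hpos : ∀ᵐ y ∂ρ, 0 < f y) : 0 < ∫ y, f y ∂ρ := by
  rw [integral_pos_iff_support_of_nonneg_ae (hpos.mono fun y hy => hy.le) hf]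
  rw [pos_iff_ne_zero]
  intro h0
  have h1 : ∀ᵐ y ∂ρ, False := by
    filter_upwards [hpos, measure_eq_zero_iff_ae_notMem.1 h0] with y hy hy' using hy' hy.ne'
  exact h1.exists.choose_spec

/-! ### Radial symmetry of the local minimizer -/

/-- A function that is locally constant on spheres is constant on spheres, in dimension at least
two. -/
theorem eq_of_locally_eq_on_spheres {d : ℕ} (hd : 2 ≤ d) {α : Type*} {f : RSp d → α}
    (hf : ∀ x, x ≠ 0 → ∀ᶠ y in 𝓝 x, ‖x‖ = ‖y‖ → f y = f x) (x y : RSp d) (hxy : ‖x‖ = ‖y‖) :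
    f x = f y := by
  rcases eq_or_ne x 0 with rfl | hx
  · rw [norm_zero, eq_comm, norm_eq_zero] at hxy
    rw [hxy]
  have hrank : 1 < Module.rank ℝ (RSp d) := by
    rw [← Module.finrank_eq_rank, finrank_euclideanSpace_fin]
    exact_mod_cast hd
  have hpre : IsPreconnected (Metric.sphere (0 : RSp d) ‖x‖) := isPreconnected_sphere hrank 0 ‖x‖
  have hps : PreconnectedSpace (Metric.sphere (0 : RSp d) ‖x‖) :=
    isPreconnected_iff_preconnectedSpace.1 hpre
  have hloc : IsLocallyConstant fun z : Metric.sphere (0 : RSp d) ‖x‖ => f z := by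
    rw [IsLocallyConstant.iff_eventually_eq]
    intro z
    have hz : ‖(z : RSp d)‖ = ‖x‖ := mem_sphere_zero_iff_norm.1 z.2
    have hz0 : (z : RSp d) ≠ 0 := norm_ne_zero_iff.1 (by rw [hz]; exact norm_ne_zero_iff.2 hx)
    have h1 := (continuous_subtype_val.tendsto z).eventually (hf z hz0)
    exact h1.mono fun w hw => hw (hz.trans (mem_sphere_zero_iff_norm.1 w.2).symm)
  exact hloc.apply_eq_of_preconnectedSpace ⟨x, by simp⟩ ⟨y, by simp [hxy]⟩

theorem mem_support_of_map_eq {d : ℕ} {ρ : Measure (RSp d)} {R : RSp d ≃ₗᵢ[ℝ] RSp d}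
    (hR : ρ.map R = ρ) {x : RSp d} (hx : x ∈ ρ.support) : R x ∈ ρ.support := by
  rw [Measure.mem_support_iff_forall] at hx ⊢
  intro U hU
  have h1 := hx _ (R.continuous.continuousAt hU)
  have h2 : ρ.map R U = ρ (R ⁻¹' U) := R.toHomeomorph.toMeasurableEquiv.map_apply U
  rwa [← h2, hR] at h1

theorem mem_support_iff_of_map_eq {d : ℕ} {ρ : Measure (RSp d)} {R : RSp d ≃ₗᵢ[ℝ] RSp d}
    (hR : ρ.map R = ρ) (x : RSp d) : R x ∈ ρ.support ↔ x ∈ ρ.support := by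
  refine ⟨fun h => ?_, mem_support_of_map_eq hR⟩
  have hR' : ρ.map R.symm = ρ := by
    conv_lhs => rw [← hR]
    rw [Measure.map_map R.symm.continuous.measurable R.continuous.measurable]
    have : R.symm ∘ R = id := funext R.symm_apply_apply
    rw [this, Measure.map_id]
  simpa using mem_support_of_map_eq hR' h

/-- In dimension at least two, the potential and the support of a local minimizer are radial. -/
theorem radial_of_localMinimizer {d : ℕ} (hd : 2 ≤ d) {W : RSp d → ℝ≥0∞} (hHs : SatisfiesHs W)
    (hLIC : IsLIC W) (hradial : ∀ x y, ‖x‖ = ‖y‖ → W x = W y)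
    {ρ : Measure (RSp d)} [IsProbabilityMeasure ρ] {ε : ℝ} (hε : 0 < ε)
    (hmin : ∀ σ : Measure (RSp d), IsProbabilityMeasure σ → dInf ρ σ < ENNReal.ofReal ε →
      interactionEnergy W ρ ≤ interactionEnergy W σ)
    {M : ℝ} (hM0 : 0 ≤ M) (hM : ∀ᵐ y ∂ρ, ‖y‖ ≤ M) (hc : Continuous (pot W ρ))
    (hfin : ∀ x, pot W ρ x < ∞) (hcenter : centerOfMass ρ = 0) (x y : RSp d) (hxy : ‖x‖ = ‖y‖) :
    pot W ρ x = pot W ρ y ∧ (x ∈ ρ.support ↔ y ∈ ρ.support) := by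
  have h := eq_of_locally_eq_on_spheres hd (f := fun x => (pot W ρ x, x ∈ ρ.support)) ?_ x y hxy
  · rw [Prod.mk.injEq, eq_iff_iff] at h
    exact h
  intro x hx
  filter_upwards [exists_isometry_near_one hx hM0 (half_pos hε)] with y hy hxy
  obtain ⟨R, hRx, hR⟩ := hy hxy
  have hmap := map_isometry_eq_self hHs hLIC hradial hmin hM hc hfin hcenter R (half_pos hε).le
    (half_lt_self hε) hR
  have h1 := pot_map_isometry hHs.continuous.measurable hradial ρ R x
  rw [hmap, hRx] at h1
  have h2 := mem_support_iff_of_map_eq hmap x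
  rw [hRx] at h2
  rw [h1, propext h2]

/-! ### Global minimality -/

/-- The potential of a local minimizer satisfies the hypotheses of the gap argument. -/
theorem isSupportPotential_of_localMinimizer {d : ℕ} (hd : 1 ≤ d) {W : RSp d → ℝ≥0∞}
    (hHs : SatisfiesHs W) (hC4 : ContDiffOn ℝ 4 (realPotential W) {0}ᶜ)
    (hradial : ∀ x y, ‖x‖ = ‖y‖ → W x = W y) (hLIC : IsLIC W)
    (hbilap : ∀ x, x ≠ 0 → Δ (Δ (realPotential W)) x < 0)
    (hlap : ∃ R : ℝ, ∀ x, R < ‖x‖ → 0 < Δ (realPotential W) x)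
    {ρ : Measure (RSp d)} [IsProbabilityMeasure ρ] (hcompact : IsCompact ρ.support) {ε : ℝ}
    (hε : 0 < ε)
    (hmin : ∀ σ : Measure (RSp d), IsProbabilityMeasure σ → dInf ρ σ < ENNReal.ofReal ε →
      interactionEnergy W ρ ≤ interactionEnergy W σ)
    {M : ℝ} (hM0 : 0 ≤ M) (hM : ∀ y ∈ ρ.support, ‖y‖ ≤ M) {G : RSp d → RSp d} (hGc : Continuous G)
    (hG : ∀ x, HasGradientAt (fun x => (pot W ρ x).toReal) (G x) x) (hc : Continuous (pot W ρ))
    (hfin : ∀ x, pot W ρ x < ∞) (hcenter : centerOfMass ρ = 0) :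
    IsSupportPotential (fun x => (pot W ρ x).toReal) ρ.support := by
  have hMae : ∀ᵐ y ∂ρ, ‖y‖ ≤ M := by
    filter_upwards [Measure.support_mem_ae (μ := ρ)] with y hy using hM y hy
  have hsupp : ∀ᵐ y ∂ρ, y ∈ ρ.support := Measure.support_mem_ae
  refine ⟨?_, fun x hx => (pot_off_support hHs hC4 hMae hx).1, fun x hx => ?_, ?_, ?_, hcompact,
    Measure.nonempty_support (IsProbabilityMeasure.ne_zero ρ), ?_⟩
  · rw [contDiff_one_iff_fderiv]
    refine ⟨fun x => (hG x).hasFDerivAt.differentiableAt, ?_⟩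
    have : fderiv ℝ (fun x => (pot W ρ x).toReal) = fun x => toDual ℝ (RSp d) (G x) :=
      funext fun x => (hG x).hasFDerivAt.fderiv
    rw [this]
    exact (toDual ℝ (RSp d)).continuous.comp hGc
  · obtain ⟨-, -, hint, heq⟩ := pot_off_support hHs hC4 hMae hx
    rw [heq, ← neg_pos, ← integral_neg]
    refine integral_pos_of_ae_pos hint.neg ?_
    filter_upwards [hsupp] with y hy
    exact neg_pos.2 (hbilap _ (sub_ne_zero.2 (by rintro rfl; exact hx hy)))
  · obtain ⟨R, hR⟩ := hlap
    refine ⟨|R| + M, fun x hx => ?_⟩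
    have hxS : x ∉ ρ.support := fun h => by
      have := hM x h
      linarith [abs_nonneg R]
    obtain ⟨-, ⟨hint, heq⟩, -⟩ := pot_off_support hHs hC4 hMae hxS
    rw [heq]
    refine integral_pos_of_ae_pos hint ?_
    filter_upwards [hMae] with y hy
    refine hR _ ?_
    linarith [norm_sub_norm_le x y, le_abs_self R]
  · exact ⟨ε, hε, fun p hp y hpy => ENNReal.toReal_mono (hfin y).ne
      (pot_le_of_mem_support hHs hmin hMae hc hfin hp hpy)⟩
  · rcases hd.eq_or_lt with h1 | h2
    · exact Or.inl h1.symm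
    · have hrad := radial_of_localMinimizer h2 hHs hLIC hradial hε hmin hM0 hMae hc hfin hcenter
      exact Or.inr ⟨h2, fun x y hxy => congrArg ENNReal.toReal (hrad x y hxy).1,
        fun x y hxy => (hrad x y hxy).2.1⟩

theorem mutualEnergy_map_sub {d : ℕ} {W : RSp d → ℝ≥0∞} (hW : Measurable W) (μ : Measure (RSp d))
    [IsFiniteMeasure μ] (c : RSp d) :
    mutualEnergy W (μ.map (· - c)) (μ.map (· - c)) = mutualEnergy W μ μ := by
  have hm : Measurable fun x : RSp d => x - c := by fun_prop
  rw [mutualEnergy, lintegral_map (measurable_pot hW _) hm]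
  refine lintegral_congr fun x => ?_
  have hm' : Measurable fun y => W (x - c - y) := hW.comp (by fun_prop)
  rw [pot, lintegral_map hm' hm]
  simp only [sub_sub_sub_cancel_right]
  rfl

theorem IsP2.memLp_id {d : ℕ} {μ : Measure (RSp d)} (h : IsP2 μ) :
    MemLp (fun x : RSp d => x) 2 μ := by
  refine ⟨measurable_id.aestronglyMeasurable, ?_⟩
  rw [eLpNorm_lt_top_iff_lintegral_rpow_enorm_lt_top two_ne_zero ENNReal.ofNat_ne_top]
  simpa using h.second_moment

theorem IsP2.map_sub {d : ℕ} {μ : Measure (RSp d)} (h : IsP2 μ) (c : RSp d) :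
    IsP2 (μ.map (· - c)) := by
  have := h.prob
  have hm : Measurable fun x : RSp d => x - c := by fun_prop
  refine ⟨Measure.isProbabilityMeasure_map hm.aemeasurable, ?_⟩
  rw [lintegral_map (by fun_prop) hm]
  have h3 := (h.memLp_id.sub (memLp_const c)).2
  rw [eLpNorm_lt_top_iff_lintegral_rpow_enorm_lt_top two_ne_zero ENNReal.ofNat_ne_top] at h3
  simpa using h3

theorem centerOfMass_map_sub {d : ℕ} {μ : Measure (RSp d)} (h : IsP2 μ) (c : RSp d) :
    centerOfMass (μ.map (· - c)) = centerOfMass μ - c := by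
  have := h.prob
  have hm : Measurable fun x : RSp d => x - c := by fun_prop
  rw [centerOfMass, integral_map (f := fun x => x) hm.aemeasurable measurable_id.aestronglyMeasurable,
    integral_sub (h.memLp_id.integrable one_le_two) (integrable_const c)]
  simp [centerOfMass]

theorem mainTheorem2 (d : ℕ) (hd : 1 ≤ d) (W : RSp d → ℝ≥0∞)
    (hHs : SatisfiesHs W)
    (hC4 : ContDiffOn ℝ 4 (realPotential W) {0}ᶜ)
    (hradial : ∀ x y, ‖x‖ = ‖y‖ → W x = W y)
    (hLIC : IsLIC W)
    (hbilap : ∀ x, x ≠ 0 → Laplacian.laplacian (Laplacian.laplacian (realPotential W)) x < 0)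
    (hlap : ∃ R : ℝ, ∀ x, R < ‖x‖ → 0 < Laplacian.laplacian (realPotential W) x)
    (ρ : Measure (RSp d))
    (hcompact : IsCompact ρ.support)
    (hlocmin : IsDInfLocalMinimizer W ρ)
    (hgrad : GradConvContinuous W ρ)
    (hcenter : centerOfMass ρ = 0) :
    IsGlobalMinimizerP2 W ρ ∧
      ∀ σ : Measure (RSp d), IsP2 σ → centerOfMass σ = 0 →
        interactionEnergy W σ ≤ interactionEnergy W ρ → σ = ρ := by
  obtain ⟨hprob, ε, hε, hmin⟩ := hlocmin
  obtain ⟨G, hGc, hG⟩ := hgrad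
  have hW := hHs.continuous.measurable
  obtain ⟨M, hM0, hM⟩ := hcompact.isBounded.exists_pos_norm_le
  have hMae : ∀ᵐ y ∂ρ, ‖y‖ ≤ M := by
    filter_upwards [Measure.support_mem_ae (μ := ρ)] with y hy using hM y hy
  obtain ⟨hfin, hdiff⟩ := pot_sub_eq hd hHs hC4 hradial hbilap hMae hGc hG
  have hgradV := hasGradientAt_of_sub_eq_integral (V := fun x => (pot W ρ x).toReal) hGc hdiff
  have hc : Continuous (pot W ρ) := by
    have h1 : Continuous fun x => (pot W ρ x).toReal :=
      continuous_iff_continuousAt.2 fun x => (hgradV x).continuousAt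
    have h2 : pot W ρ = fun x => ENNReal.ofReal (pot W ρ x).toReal :=
      funext fun x => (ENNReal.ofReal_toReal (hfin x).ne).symm
    rw [h2]
    exact ENNReal.continuous_ofReal.comp h1
  have hV := isSupportPotential_of_localMinimizer hd hHs hC4 hradial hLIC hbilap hlap hcompact hε
    hmin hM0.le hM hGc hgradV hc hfin hcenter
  have hρ2 : IsP2 ρ := isP2_of_ae_bound hMae
  have hEρ : interactionEnergy W ρ < ∞ := by
    have := lintegral_ne_top_of_bound (exists_bound_of_continuous_finite hc hfin M) hMae
    rw [interactionEnergy_eq]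
    exact ENNReal.mul_lt_top (by simp) (lt_top_iff_ne_top.2 this)
  obtain ⟨p, hp⟩ := hV.nonempty
  have hpmin : ∀ q ∈ ρ.support, ∀ x, pot W ρ q ≤ pot W ρ x := fun q hq x =>
    (ENNReal.toReal_le_toReal (hfin q).ne (hfin x).ne).1 (hV.le hq x)
  -- The potential equals its minimum on the support, so its `ρ`-average is at most any average.
  have hEL : ∀ σ : Measure (RSp d), IsProbabilityMeasure σ →
      mutualEnergy W ρ ρ ≤ mutualEnergy W ρ σ := by
    intro σ hσ
    rw [mutualEnergy_comm hW hHs.symm ρ σ]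
    have h1 : mutualEnergy W ρ ρ ≤ pot W ρ p := by
      have h2 : mutualEnergy W ρ ρ ≤ ∫⁻ _, pot W ρ p ∂ρ := by
        refine lintegral_mono_ae ?_
        filter_upwards [Measure.support_mem_ae (μ := ρ)] with q hq using hpmin q hq p
      simpa using h2
    have h3 : pot W ρ p ≤ mutualEnergy W σ ρ := by
      have h4 : ∫⁻ _, pot W ρ p ∂σ ≤ mutualEnergy W σ ρ := lintegral_mono fun x => hpmin p hp x
      simpa using h4
    exact h1.trans h3
  have hlt : ∀ σ : Measure (RSp d), IsP2 σ → centerOfMass σ = 0 → σ ≠ ρ →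
      interactionEnergy W ρ < interactionEnergy W σ := fun σ hσ hσ0 hne =>
    hLIC.energy_lt hW hHs.symm hρ2 hσ hne.symm hEρ (hcenter.trans hσ0.symm) (hEL σ hσ.prob)
  refine ⟨⟨hρ2, fun σ hσ => ?_⟩, fun σ hσ hσ0 hle => ?_⟩
  · have := hσ.prob
    -- The energy is translation invariant, so the center of mass can be moved to the origin.
    set σ' := σ.map (· - centerOfMass σ) with hσ'
    have h1 : interactionEnergy W σ' = interactionEnergy W σ := by
      rw [interactionEnergy_eq, interactionEnergy_eq, mutualEnergy_map_sub hW]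
    rw [← h1]
    rcases eq_or_ne σ' ρ with h | h
    · rw [h]
    · exact (hlt σ' (hσ.map_sub _) (by rw [hσ', centerOfMass_map_sub hσ, sub_self]) h).le
  · by_contra hne
    exact absurd hle (not_le.2 (hlt σ hσ hσ0 hne))

end
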